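/- **Streaming differential privacy.** Let $\varepsilon>0$, $0<\delta<1$, $n,d\ge 1$ with $\delta\sqrt{2\pi}\le d^2$ (automatic if $d\ge2$), and put $$\omega=\omega(\varepsilon,\delta,d,n)=\frac{4d}{\varepsilon n}\sqrt{2\log\Big(\frac{d^2}{\delta\sqrt{2\pi}}\Big)}+\frac{\sqrt2}{\sqrt\varepsilon\,n}.$$ A dataset is a matrix $\mathbf X=[\mathbf x_1\cdots \mathbf x_n]\in\mathbb R^{d\times n}$ with $\|\mathbf x_i\|\le1$ for all $i$; two datasets are neighbours if they differ in a single column. A randomised algorithm $\mathcal A$ is $(\varepsilon,\delta)$-differentially private if $\mathbb P[\mathcal A(\mathbf X)\in S]\le e^{\varepsilon}\,\mathbb P[\mathcal A(\mathbf X')\in S]+\delta$ for all neighbouring datasets and all measurable $S$. For a (non-symmetric) random matrix $\mathbf N\in\mathbb R^{d\times d}$ let $\mathbf A=\frac1n\mathbf X\mathbf X^T+\mathbf N$, and for a block size $c$ let the streaming updates be $$\mathbf A_{k,c}=\frac1n\,\mathbf X\,\big[(\mathbf X^T)_{(k-1)c+1}\ \cdots\ (\mathbf X^T)_{kc}\big]+\mathbf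 N_{(k-1)c+1,\dots,kc},\qquad k=1,\dots,\lfloor d/c\rfloor,$$ where subscripts on the right denote columns. 1. If the entries of $\mathbf N$ are i.i.d. $\mathcal N(0,\omega^2)$, then the (joint) release of all updates $(\mathbf A_{k,c})_k$ is $(\varepsilon,\delta)$-differentially private. 2. If $\omega_0>0$, the entries of $\mathbf N$ are i.i.d. $\mathcal N(0,\omega_0^2)$ and $$n\ \ge\ T_{\varepsilon,\delta,d,n}:=\omega_0^{-1}\Big[4d\,\varepsilon^{-1}\sqrt{2\log\big(d^2\delta^{-1}(2\pi)^{-1/2}\big)}+\sqrt{2\varepsilon^{-1}}\Big],$$ then the release of all updates $(\mathbf A_{k,c})_k$ is $(\varepsilon,\delta)$-differentially private. 3. There are absolute constants $C_1,C_2>0$ such that the following holds for all $d\ge2$, $n\ge1$, $\varepsilon>0$, $0<\delta<1$, with the entries of $\mathbf N$ i.i.d. $\mathcal N(0,\omega^2)$. Let $\hat{\mathbf v}_1=\hat{\mathbf v}_1(\mathbf A)\in\mathbb C^d$ be computed from $\mathbf A$ by any measurable rule whose values are unit vectors (for instance a leading eigenvector, or a real leading left singular vector, of $\mathbf A$). Let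 $$\Phi=\Big[\max\Big\{\tfrac1{\sqrt{2\pi d}},\ \sqrt{1-e^{-\frac{2\log(8d)}{d-1}}},\ \sqrt{1-e^{-\frac{2/\omega^2+\log256}{d-1}}}\Big\},\,1\Big),\qquad F(\phi)=1-\frac{1/\omega^2+\log2}{(d-1)\log\frac1{\sqrt{1-\phi^2}}-\log8}.$$ Then the minimum and the maximum below are attained, and there is a dataset $\mathbf X$ of $n$ points with $\|\mathbf x_i\|\le 1$ such that for every top unit eigenvector $\mathbf v_1\in\mathbb R^d$ of $\frac1n\mathbf X\mathbf X^T$, $$\mathbb E\,|\langle\mathbf v_1,\hat{\mathbf v}_1\rangle|\ \le\ \min_{\phi\in\Phi}\Big(1-\frac{1-\phi}4F(\phi)^2\Big),\qquad \mathbb E\,\|\mathbf v_1-\hat{\mathbf v}_1\|\ \ge\ \max_{\phi\in\Phi}\frac{\sqrt{2(1-\phi)}}2F(\phi),$$ $$n\ \ge\ C_1\,\frac{d^{3/2}\sqrt{\log(d/\delta)}}{\varepsilon}\Big(1-C_2\big(1-\mathbb E\,|\langle\mathbf v_1,\hat{\mathbf v}_1\rangle|\big)\Big).$$ -/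

import Mathlib

open MeasureTheory ProbabilityTheory
open scoped Matrix

namespace StreamingDP

noncomputable section

/-- A dataset of `n` points of `ℝ^d` (with the Euclidean norm). -/
abbrev Dataset (d n : ℕ) : Type := Fin n → EuclideanSpace ℝ (Fin d)

/-- The datasets all of whose points lie in the closed Euclidean unit ball. -/
def boundedDatasets (d n : ℕ) : Set (Dataset d n) := {X | ∀ i, ‖X i‖ ≤ 1}

/-- The `d × n` matrix whose columns are the data points. -/
def dataMatrix {d n : ℕ} (X : Dataset d n) : Matrix (Fin d) (Fin n) ℝ :=
  Matrix.of fun i j => X j i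

/-- The covariance matrix `(1/n) X Xᵀ`. -/
def cov {d n : ℕ} (X : Dataset d n) : Matrix (Fin d) (Fin d) ℝ :=
  (1 / (n : ℝ)) • (dataMatrix X * (dataMatrix X)ᵀ)

/-- The perturbed covariance matrix `A = (1/n) X Xᵀ + N`. -/
def perturbedCov {d n : ℕ} (X : Dataset d n) (N : Matrix (Fin d) (Fin d) ℝ) :
    Matrix (Fin d) (Fin d) ℝ :=
  cov X + N

/-- The column index `k c + j` (everything counted from `0`). -/
def blockIndex {d c : ℕ} (k : Fin (d / c)) (j : Fin c) : Fin d :=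
  ⟨k * c + j, by
    have h1 : ((k : ℕ) + 1) * c ≤ d / c * c := Nat.mul_le_mul_right c k.isLt
    have h2 : d / c * c ≤ d := Nat.div_mul_le_self d c
    have h3 : ((k : ℕ) + 1) * c = k * c + c := Nat.succ_mul _ _
    have h4 := j.isLt
    omega⟩

/-- The columns `k c, …, k c + c - 1` of a matrix with `d` columns. -/
def colBlock {m : Type*} {d : ℕ} (c : ℕ) (M : Matrix m (Fin d) ℝ) (k : Fin (d / c)) :
    Matrix m (Fin c) ℝ :=
  M.submatrix id (blockIndex k)

/-- The `k`-th streaming update `(1/n) X [(Xᵀ)_{kc} ⋯ (Xᵀ)_{kc+c-1}] + N^{d × c}`, the mask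
`N^{d × c}` being the corresponding columns of `N`. -/
def streamUpdate {d n : ℕ} (c : ℕ) (X : Dataset d n) (N : Matrix (Fin d) (Fin d) ℝ)
    (k : Fin (d / c)) : Matrix (Fin d) (Fin c) ℝ :=
  (1 / (n : ℝ)) • (dataMatrix X * colBlock c (dataMatrix X)ᵀ k) + colBlock c N k

/-- The updates are the successive column blocks of `A`. -/
theorem streamUpdate_eq {d n : ℕ} (c : ℕ) (X : Dataset d n) (N : Matrix (Fin d) (Fin d) ℝ)
    (k : Fin (d / c)) : streamUpdate c X N k = colBlock c (perturbedCov X N) k := by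
  ext i j
  simp [streamUpdate, colBlock, perturbedCov, cov, Matrix.mul_apply]

/-- Matrices carry the product (entrywise Borel) σ-algebra. -/
instance matrixMeasurableSpace {m k : Type*} : MeasurableSpace (Matrix m k ℝ) :=
  inferInstanceAs (MeasurableSpace (m → k → ℝ))

/-- The law of a (non-symmetric) `d × d` matrix with i.i.d. entries `N(0, σ²)`. -/
def gaussianNoise (d : ℕ) (σ : ℝ) : Measure (Matrix (Fin d) (Fin d) ℝ) :=
  Measure.pi fun _ => Measure.pi fun _ => gaussianReal 0 (σ ^ 2).toNNReal

/-- `(ε, δ)`-differential privacy, over the datasets in `𝒟`, of the randomised algorithm that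
outputs `M X ω` on the dataset `X`, where the randomness `ω` has law `P`. Two datasets are
neighbours if they differ in (at most) one data point. -/
def IsDifferentiallyPrivate {Ω T E : Type*} [MeasurableSpace Ω] [MeasurableSpace T] {n : ℕ}
    (P : Measure Ω) (𝒟 : Set (Fin n → E)) (M : (Fin n → E) → Ω → T) (ε δ : ℝ) : Prop :=
  ∀ X ∈ 𝒟, ∀ X' ∈ 𝒟, (∃ i, ∀ j, j ≠ i → X j = X' j) →
    ∀ S : Set T, MeasurableSet S →
      P {ω | M X ω ∈ S} ≤
        ENNReal.ofReal (Real.exp ε) * P {ω | M X' ω ∈ S} + ENNReal.ofReal δ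

/-- The noise level
`ω(ε, δ, d, n) = (4d / (ε n)) √(2 log (d² / (δ √(2π)))) + √2 / (√ε n)`. -/
def noiseLevel (ε δ : ℝ) (d n : ℕ) : ℝ :=
  4 * d / (ε * n) * √(2 * Real.log ((d : ℝ) ^ 2 / (δ * √(2 * Real.pi)))) + √2 / (√ε * n)

/-- The minimum batch size
`T = ω₀⁻¹ (4 d ε⁻¹ √(2 log (d² δ⁻¹ (2π)^{-1/2})) + √(2 ε⁻¹))`. -/
def minBatch (ω₀ ε δ : ℝ) (d : ℕ) : ℝ :=
  ω₀⁻¹ * (4 * d * ε⁻¹ *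
    √(2 * Real.log ((d : ℝ) ^ 2 * δ⁻¹ * (2 * Real.pi) ^ (-(1 / 2) : ℝ))) + √(2 * ε⁻¹))

/-- `v` is a unit eigenvector of `S` belonging to its largest (real) eigenvalue. -/
def IsTopEigenvector {d : ℕ} (S : Matrix (Fin d) (Fin d) ℝ) (v : EuclideanSpace ℝ (Fin d)) :
    Prop :=
  ‖v‖ = 1 ∧ ∃ l : ℝ, Module.End.HasEigenvector (Matrix.toEuclideanLin S) l v ∧
    ∀ l' : ℝ, Module.End.HasEigenvalue (Matrix.toEuclideanLin S) l' → l' ≤ l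

/-- A real vector, regarded as a vector of `ℂ^d`. -/
def toComplex {d : ℕ} (v : EuclideanSpace ℝ (Fin d)) : EuclideanSpace ℂ (Fin d) :=
  WithLp.toLp 2 fun i => (v i : ℂ)

/-- The range of the parameter `φ` in the utility bounds, at noise level `σ`. -/
def phiRange (d : ℕ) (σ : ℝ) : Set ℝ :=
  Set.Ico
    (max (1 / √(2 * Real.pi * d))
      (max (√(1 - Real.exp (-(2 * Real.log (8 * d) / (d - 1)))))
        (√(1 - Real.exp (-((2 / σ ^ 2 + Real.log 256) / (d - 1))))))) 1

/-- The factor `1 - (1/σ² + log 2) / ((d-1) log (1/√(1-φ²)) - log 8)`. -/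
def fanoFactor (d : ℕ) (σ φ : ℝ) : ℝ :=
  1 - (1 / σ ^ 2 + Real.log 2) /
    (((d : ℝ) - 1) * Real.log (1 / √(1 - φ ^ 2)) - Real.log 8)

/-- Upper bound on the expected correlation, as a function of `φ`. -/
def correlationBound (d : ℕ) (σ φ : ℝ) : ℝ :=
  1 - (1 - φ) / 4 * fanoFactor d σ φ ^ 2

/-- Lower bound on the expected distance, as a function of `φ`. -/
def distanceBound (d : ℕ) (σ φ : ℝ) : ℝ :=
  √(2 * (1 - φ)) / 2 * fanoFactor d σ φ

/-- `E |⟨v₁, v̂₁⟩|`, where `v̂₁` is obtained from `A = (1/n) X Xᵀ + N` by the rule `vhat`, and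
`N` has i.i.d. entries `N(0, σ²)`. -/
def expectedCorrelation {d n : ℕ} (X : Dataset d n) (σ : ℝ) (v₁ : EuclideanSpace ℝ (Fin d))
    (vhat : Matrix (Fin d) (Fin d) ℝ → EuclideanSpace ℂ (Fin d)) : ℝ :=
  ∫ N, ‖inner ℂ (toComplex v₁) (vhat (perturbedCov X N))‖ ∂(gaussianNoise d σ)

/-- `E ‖v₁ - v̂₁‖`, with the same conventions. -/
def expectedDistance {d n : ℕ} (X : Dataset d n) (σ : ℝ) (v₁ : EuclideanSpace ℝ (Fin d))
    (vhat : Matrix (Fin d) (Fin d) ℝ → EuclideanSpace ℂ (Fin d)) : ℝ :=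
  ∫ N, ‖toComplex v₁ - vhat (perturbedCov X N)‖ ∂(gaussianNoise d σ)

end

end StreamingDP

namespace StreamingDP

/-! Privacy. The release is a measurable function of the covariance plus noise, so it suffices to
compare the noise law `Q` with its translate by `D`, the difference of two neighbouring covariance
matrices, for which `‖D‖_F² ≤ 2/n²` (`sum_sq_cov_sub_le`). If `L` is the log-density of the
translate, then pointwise `e^L ≤ e^ε + (2π)^(-1/2) e^(-λε) e^((λ+1)L)` for `λ ≥ 1/2`
(`exp_le_exp_add`). Integrated over an event, the first term gives `e^ε Q` and the second is at most
an explicit Gaussian exponential moment (`gaussianNoise_add_mem_le`); the noise level is large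
enough to push it below `δ` for a suitable `λ`.

Utility. Fed with pure noise, the rule returns a unit vector that knows nothing about the data. A
narrow double cone fills an exponentially small part of the unit ball, so by averaging there is a
fixed direction `v` with which this output is well correlated only with tiny probability
(`exists_norm_eq_one_measure_le`). Taking every data point equal to `v` merely translates the noise
by `v vᵀ`, at a relative entropy of `1/(2σ²)`, and the entropy inequality
`mul_measureReal_add_mem_le` bounds the probability of the same event after the translation. Both
utility bounds are monotone in `(1 - φ) F(φ)²`, so one maximiser `φ`, and hence one dataset, serves
both.

Sample complexity is a dichotomy. If `σ < 1/√d`, the formula for the noise level forces `n` to be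
large. Otherwise a fixed `φ` keeps the correlation away from `1`, and a large `C₂` makes the claimed
lower bound nonpositive. -/

/-! ### Densities and exponential moments of translated Gaussian noise -/

/-- A product of probability measures with densities has the product density. -/
theorem pi_withDensity {ι : Type*} [Fintype ι] {X : ι → Type*} [∀ i, MeasurableSpace (X i)]
    (μ : ∀ i, Measure (X i)) [∀ i, IsProbabilityMeasure (μ i)] (f : ∀ i, X i → ENNReal)
    (hf : ∀ i, Measurable (f i)) [∀ i, IsProbabilityMeasure ((μ i).withDensity (f i))] :
    Measure.pi (fun i => (μ i).withDensity (f i)) =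
      (Measure.pi μ).withDensity fun x => ∏ i, f i (x i) := by
  refine Measure.pi_eq fun s hs => ?_
  rw [withDensity_apply _ (.univ_pi hs), ← lintegral_indicator (.univ_pi hs)]
  have h : ∀ x, (Set.univ.pi s).indicator (fun x => ∏ i, f i (x i)) x =
      ∏ i, (s i).indicator (f i) (x i) := by
    intro x
    by_cases hx : x ∈ Set.univ.pi s
    · rw [Set.indicator_of_mem hx]
      exact Finset.prod_congr rfl fun i _ => (Set.indicator_of_mem (hx i (Set.mem_univ i)) _).symm
    · rw [Set.indicator_of_notMem hx]
      simp only [Set.mem_pi, Set.mem_univ, true_imp_iff, not_forall] at hx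
      obtain ⟨i, hi⟩ := hx
      exact (Finset.prod_eq_zero (Finset.mem_univ i) (Set.indicator_of_notMem hi _)).symm
  have hm : ∀ i, Measurable ((s i).indicator (f i)) := fun i => (hf i).indicator (hs i)
  simp_rw [h]
  refine (lintegral_prod_eq_prod_lintegral_of_indepFun Finset.univ
    (fun i (x : ∀ i, X i) => (s i).indicator (f i) (x i))
    (iIndepFun_pi fun i => (hm i).aemeasurable)
    fun i => (hm i).comp (measurable_pi_apply i)).trans ?_
  refine Finset.prod_congr rfl fun i _ => ?_
  rw [withDensity_apply _ (hs i), ← lintegral_indicator (hs i)]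
  exact (measurePreserving_eval μ i).lintegral_comp (hm i)

/-- The density of a shifted centred Gaussian with respect to the unshifted one. -/
theorem gaussianReal_eq_withDensity {σ : ℝ} (hσ : 0 < σ) (m : ℝ) :
    gaussianReal m (σ ^ 2).toNNReal = (gaussianReal 0 (σ ^ 2).toNNReal).withDensity
      fun x => ENNReal.ofReal (Real.exp (m * x / σ ^ 2 - m ^ 2 / (2 * σ ^ 2))) := by
  have hv : (σ ^ 2).toNNReal ≠ 0 := by
    simpa using hσ.ne'
  have hc : (((σ ^ 2).toNNReal : NNReal) : ℝ) = σ ^ 2 := Real.coe_toNNReal _ (sq_nonneg σ)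
  rw [gaussianReal_of_var_ne_zero _ hv, gaussianReal_of_var_ne_zero _ hv,
    ← withDensity_mul _ (measurable_gaussianPDF _ _) (by fun_prop)]
  congr 1
  ext x
  simp only [Pi.mul_apply, gaussianPDF, gaussianPDFReal, hc]
  rw [← ENNReal.ofReal_mul (by positivity), mul_assoc _ (Real.exp _), ← Real.exp_add]
  congr 3
  field_simp
  ring

/-- If every factor of a product measure is mapped to a measure with log-density `f i`, then the
product is mapped to a measure whose log-density is the sum of the `f i`. -/
theorem pi_map_eq_withDensity {ι : Type*} [Fintype ι] {X : ι → Type*} [∀ i, MeasurableSpace (X i)]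
    {μ : ∀ i, Measure (X i)} [∀ i, IsProbabilityMeasure (μ i)] {g : ∀ i, X i → X i}
    {f : ∀ i, X i → ℝ} (hg : ∀ i, Measurable (g i)) (hf : ∀ i, Measurable (f i))
    (h : ∀ i, (μ i).map (g i) = (μ i).withDensity fun x => ENNReal.ofReal (Real.exp (f i x))) :
    (Measure.pi μ).map (fun x i => g i (x i)) =
      (Measure.pi μ).withDensity fun x => ENNReal.ofReal (Real.exp (∑ i, f i (x i))) := by
  have hp : ∀ i, IsProbabilityMeasure ((μ i).map (g i)) := fun i =>
    Measure.isProbabilityMeasure_map (hg i).aemeasurable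
  have hp' : ∀ i, IsProbabilityMeasure
      ((μ i).withDensity fun x => ENNReal.ofReal (Real.exp (f i x))) := fun i => h i ▸ hp i
  rw [Measure.pi_map_pi fun i => (hg i).aemeasurable, funext h,
    pi_withDensity _ _ fun i => (hf i).exp.ennreal_ofReal]
  congr 1
  ext x
  rw [Real.exp_sum, ENNReal.ofReal_prod_of_nonneg fun i _ => (Real.exp_nonneg _)]

/-- The logarithm of the density, with respect to the noise with standard deviation `σ`, of the
noise shifted by `D`. -/
noncomputable def logRatio {d : ℕ} (σ : ℝ) (D N : Matrix (Fin d) (Fin d) ℝ) : ℝ :=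
  ∑ i, ∑ j, (D i j * N i j / σ ^ 2 - D i j ^ 2 / (2 * σ ^ 2))

theorem logRatio_eq {d : ℕ} (σ : ℝ) (D N : Matrix (Fin d) (Fin d) ℝ) :
    logRatio σ D N = (∑ i, ∑ j, D i j * N i j) / σ ^ 2 - (∑ i, ∑ j, D i j ^ 2) / (2 * σ ^ 2) := by
  simp only [logRatio, Finset.sum_sub_distrib, Finset.sum_div]

theorem measurable_entry {d : ℕ} (i j : Fin d) :
    Measurable fun N : Matrix (Fin d) (Fin d) ℝ => N i j :=
  (measurable_pi_apply j).comp (measurable_pi_apply (X := fun _ : Fin d => Fin d → ℝ) i)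

theorem measurable_add_matrix {d : ℕ} (D : Matrix (Fin d) (Fin d) ℝ) :
    Measurable fun N : Matrix (Fin d) (Fin d) ℝ => N + D :=
  measurable_pi_iff.2 fun i => measurable_pi_iff.2 fun j => (measurable_entry i j).add_const (D i j)

theorem measurable_logRatio {d : ℕ} (σ : ℝ) (D : Matrix (Fin d) (Fin d) ℝ) :
    Measurable (logRatio σ D) := by
  have h := measurable_entry (d := d)
  unfold logRatio
  fun_prop

instance isProbabilityMeasure_gaussianNoise (d : ℕ) (σ : ℝ) :
    IsProbabilityMeasure (gaussianNoise d σ) :=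
  inferInstanceAs (IsProbabilityMeasure (Measure.pi fun _ : Fin d => Measure.pi fun _ : Fin d =>
    gaussianReal 0 (σ ^ 2).toNNReal))

theorem gaussianNoise_map_add {d : ℕ} {σ : ℝ} (hσ : 0 < σ) (D : Matrix (Fin d) (Fin d) ℝ) :
    (gaussianNoise d σ).map (fun N => N + D) =
      (gaussianNoise d σ).withDensity fun N => ENNReal.ofReal (Real.exp (logRatio σ D N)) := by
  have h (m : ℝ) : (gaussianReal 0 (σ ^ 2).toNNReal).map (fun x => x + m) =
      (gaussianReal 0 (σ ^ 2).toNNReal).withDensity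
        fun x => ENNReal.ofReal (Real.exp (m * x / σ ^ 2 - m ^ 2 / (2 * σ ^ 2))) := by
    rw [gaussianReal_map_add_const, zero_add, gaussianReal_eq_withDensity hσ]
  have h' (m : Fin d → ℝ) := pi_map_eq_withDensity (μ := fun _ : Fin d =>
    gaussianReal 0 (σ ^ 2).toNNReal) (fun _ => by fun_prop) (fun _ => by fun_prop)
    fun j => h (m j)
  exact pi_map_eq_withDensity (μ := fun _ : Fin d => Measure.pi fun _ : Fin d =>
    gaussianReal 0 (σ ^ 2).toNNReal) (fun _ => by fun_prop) (fun _ => by fun_prop)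
    fun i => h' (D i)

/-- Change of measure for the shifted noise. -/
theorem lintegral_gaussianNoise_add {d : ℕ} {σ : ℝ} (hσ : 0 < σ) (D : Matrix (Fin d) (Fin d) ℝ)
    {f : Matrix (Fin d) (Fin d) ℝ → ENNReal} (hf : Measurable f) :
    ∫⁻ N, f (N + D) ∂gaussianNoise d σ =
      ∫⁻ N, ENNReal.ofReal (Real.exp (logRatio σ D N)) * f N ∂gaussianNoise d σ := by
  rw [← lintegral_map hf (measurable_add_matrix D), gaussianNoise_map_add hσ, lintegral_withDensity_eq_lintegral_mul _
    (measurable_logRatio σ D).exp.ennreal_ofReal hf]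
  rfl

theorem lintegral_exp_logRatio {d : ℕ} {σ : ℝ} (hσ : 0 < σ) (D : Matrix (Fin d) (Fin d) ℝ) :
    ∫⁻ N, ENNReal.ofReal (Real.exp (logRatio σ D N)) ∂gaussianNoise d σ = 1 := by
  have := lintegral_gaussianNoise_add hσ D (f := fun _ => 1) measurable_const
  simpa using this.symm

/-- Exponential moments of the log-density. -/
theorem lintegral_exp_mul_logRatio {d : ℕ} {σ : ℝ} (hσ : 0 < σ) (D : Matrix (Fin d) (Fin d) ℝ)
    (s : ℝ) :
    ∫⁻ N, ENNReal.ofReal (Real.exp (s * logRatio σ D N)) ∂gaussianNoise d σ =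
      ENNReal.ofReal (Real.exp ((s ^ 2 - s) * (∑ i, ∑ j, D i j ^ 2) / (2 * σ ^ 2))) := by
  -- Scaling the log-density by `s` gives, up to a constant, the log-density of the shift by `s •
  -- D`, whose exponential integrates to `1`.
  have h : ∀ N, s * logRatio σ D N =
      (s ^ 2 - s) * (∑ i, ∑ j, D i j ^ 2) / (2 * σ ^ 2) + logRatio σ (s • D) N := by
    intro N
    have e1 : ∑ i, ∑ j, (s • D) i j * N i j = s * ∑ i, ∑ j, D i j * N i j := by
      simp [Finset.mul_sum, mul_assoc]
    have e2 : ∑ i, ∑ j, (s • D) i j ^ 2 = s ^ 2 * ∑ i, ∑ j, D i j ^ 2 := by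
      simp [Finset.mul_sum, mul_pow]
    rw [logRatio_eq, logRatio_eq, e1, e2]
    ring
  simp_rw [h, Real.exp_add, ENNReal.ofReal_mul (Real.exp_nonneg _)]
  rw [lintegral_const_mul _ (measurable_logRatio _ _).exp.ennreal_ofReal,
    lintegral_exp_logRatio hσ, mul_one]

/-! ### Privacy of the Gaussian mechanism -/

/-- After division by `e^ε`, only `x ≥ ε` matters. There, with `z = e^((x-ε)/2) ≥ 1` and `λ + 1 ≥
3/2`, it is enough that `z² ≤ 1 + c z³`. This holds for all `z ≥ 0` once `c² ≥ 4/27`, which `c =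
1/√(2π)` satisfies with little to spare; hence the rational bound `7/18`. -/
theorem exp_le_exp_add {ε lam : ℝ} (hlam : 1 / 2 ≤ lam) (x : ℝ) :
    Real.exp x ≤ Real.exp ε +
      1 / √(2 * Real.pi) * Real.exp (-(lam * ε)) * Real.exp ((lam + 1) * x) := by
  have hc : 7 / 18 ≤ 1 / √(2 * Real.pi) := by
    rw [div_le_div_iff₀ (by norm_num) (by positivity), one_mul]
    have : √(2 * Real.pi) ≤ 18 / 7 :=
      Real.sqrt_le_iff.2 ⟨by norm_num, by nlinarith [Real.pi_lt_d2]⟩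
    linarith
  have key : Real.exp (x - ε) ≤ 1 + 1 / √(2 * Real.pi) * Real.exp ((lam + 1) * (x - ε)) := by
    rcases le_total (x - ε) 0 with h | h
    · have := Real.exp_le_one_iff.2 h
      have : 0 ≤ 1 / √(2 * Real.pi) * Real.exp ((lam + 1) * (x - ε)) := by positivity
      linarith
    · have h1 : Real.exp ((x - ε) / 2) ^ 2 = Real.exp (x - ε) := by
        rw [← Real.exp_nat_mul]; congr 1; push_cast; ring
      have h2 : Real.exp ((x - ε) / 2) ^ 3 ≤ Real.exp ((lam + 1) * (x - ε)) := by
        rw [← Real.exp_nat_mul]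
        refine Real.exp_le_exp.2 ?_
        push_cast
        nlinarith
      have hz := Real.exp_pos ((x - ε) / 2)
      set z := Real.exp ((x - ε) / 2)
      have h3 : 7 / 18 * z ^ 3 ≤ 1 / √(2 * Real.pi) * Real.exp ((lam + 1) * (x - ε)) := by
        gcongr
      -- `12/7` is the minimiser of `1 + (7/18) z³ - z²` on `z > 0`.
      nlinarith [mul_nonneg hz.le (sq_nonneg (z - 12 / 7)), sq_nonneg (z - 12 / 7)]
  have h := mul_le_mul_of_nonneg_left key (Real.exp_nonneg ε)
  have e1 : Real.exp ε * Real.exp (x - ε) = Real.exp x := by rw [← Real.exp_add]; congr 1; ring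
  have e2 : Real.exp ε * Real.exp ((lam + 1) * (x - ε)) =
      Real.exp (-(lam * ε)) * Real.exp ((lam + 1) * x) := by
    rw [← Real.exp_add, ← Real.exp_add]; congr 1; ring
  rw [e1] at h
  calc Real.exp x ≤ _ := h
    _ = Real.exp ε + 1 / √(2 * Real.pi) *
        (Real.exp ε * Real.exp ((lam + 1) * (x - ε))) := by ring
    _ = _ := by rw [e2]; ring

/-- Privacy of the additive Gaussian noise under a shift by `D`. -/
theorem gaussianNoise_add_mem_le {d : ℕ} {σ : ℝ} (hσ : 0 < σ) (D : Matrix (Fin d) (Fin d) ℝ)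
    {T : Set (Matrix (Fin d) (Fin d) ℝ)} (hT : MeasurableSet T) {ε δ lam : ℝ} (hlam : 1 / 2 ≤ lam)
    (hδ : 1 / √(2 * Real.pi) *
      Real.exp (-(lam * ε) + lam * (lam + 1) * (∑ i, ∑ j, D i j ^ 2) / (2 * σ ^ 2)) ≤ δ) :
    gaussianNoise d σ {N | N + D ∈ T} ≤
      ENNReal.ofReal (Real.exp ε) * gaussianNoise d σ T + ENNReal.ofReal δ := by
  have h1 : gaussianNoise d σ {N | N + D ∈ T} =
      ∫⁻ N, T.indicator (fun N => ENNReal.ofReal (Real.exp (logRatio σ D N))) N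
        ∂gaussianNoise d σ := by
    calc gaussianNoise d σ {N | N + D ∈ T} = (gaussianNoise d σ).map (fun N => N + D) T :=
          (Measure.map_apply (measurable_add_matrix D) hT).symm
      _ = _ := by
          rw [gaussianNoise_map_add hσ, withDensity_apply _ hT, lintegral_indicator hT]
  set K := 1 / √(2 * Real.pi) * Real.exp (-(lam * ε)) with hK
  have hK0 : 0 ≤ K := by positivity
  have hm : Measurable fun N => ENNReal.ofReal (Real.exp ((lam + 1) * logRatio σ D N)) :=
    ((measurable_logRatio σ D).const_mul _).exp.ennreal_ofReal
  calc gaussianNoise d σ {N | N + D ∈ T}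
      ≤ ∫⁻ N, (T.indicator (fun _ => ENNReal.ofReal (Real.exp ε)) N +
          ENNReal.ofReal K * ENNReal.ofReal (Real.exp ((lam + 1) * logRatio σ D N)))
          ∂gaussianNoise d σ := by
        rw [h1]
        refine lintegral_mono fun N => ?_
        by_cases hN : N ∈ T
        · simp only [Set.indicator_of_mem hN]
          rw [← ENNReal.ofReal_mul hK0, ← ENNReal.ofReal_add (by positivity) (by positivity)]
          exact ENNReal.ofReal_le_ofReal (exp_le_exp_add hlam _)
        · simp [Set.indicator_of_notMem hN]
    _ = ENNReal.ofReal (Real.exp ε) * gaussianNoise d σ T + ENNReal.ofReal (K *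
          Real.exp (((lam + 1) ^ 2 - (lam + 1)) * (∑ i, ∑ j, D i j ^ 2) / (2 * σ ^ 2))) := by
        rw [lintegral_add_right _ (hm.const_mul _), lintegral_const_mul _ hm,
          lintegral_exp_mul_logRatio hσ, lintegral_indicator_const hT, ENNReal.ofReal_mul hK0]
    _ ≤ _ := by
        gcongr
        refine le_trans (le_of_eq ?_) hδ
        rw [hK, mul_assoc, ← Real.exp_add]
        congr 3
        ring

/-- The Frobenius sensitivity of the covariance matrix. -/
theorem sum_sq_cov_sub_le {d n : ℕ} {X X' : Dataset d n} (hX : X ∈ boundedDatasets d n)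
    (hX' : X' ∈ boundedDatasets d n) (i : Fin n) (h : ∀ j, j ≠ i → X j = X' j) :
    ∑ k, ∑ l, (cov X - cov X') k l ^ 2 ≤ 2 / (n : ℝ) ^ 2 := by
  have e : ∀ k l, (cov X - cov X') k l = 1 / (n : ℝ) * (X i k * X i l - X' i k * X' i l) := by
    intro k l
    have : ∑ j, (X j k * X j l - X' j k * X' j l) = X i k * X i l - X' i k * X' i l := by
      refine Finset.sum_eq_single i (fun j _ hj => ?_) (by simp)
      rw [h j hj, sub_self]
    rw [← this]
    simp [cov, dataMatrix, Matrix.mul_apply, mul_sub]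
  have hn : ∀ Y ∈ boundedDatasets d n, ∑ k, Y i k ^ 2 ≤ 1 := by
    intro Y hY
    rw [← EuclideanSpace.real_norm_sq_eq]
    exact pow_le_one₀ (norm_nonneg _) (hY i)
  have h1 := hn X hX
  have h2 := hn X' hX'
  have p1 : 0 ≤ ∑ k, X i k ^ 2 := Finset.sum_nonneg fun _ _ => sq_nonneg _
  have p2 : 0 ≤ ∑ k, X' i k ^ 2 := Finset.sum_nonneg fun _ _ => sq_nonneg _
  -- `‖xxᵀ - yyᵀ‖_F² = ‖x‖⁴ + ‖y‖⁴ - 2⟨x,y⟩²`; dropping the last term leaves at most `2`.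
  have key : ∑ k, ∑ l, (X i k * X i l - X' i k * X' i l) ^ 2 =
      (∑ k, X i k ^ 2) * (∑ k, X i k ^ 2) + (∑ k, X' i k ^ 2) * (∑ k, X' i k ^ 2)
        - 2 * ((∑ k, X i k * X' i k) * ∑ k, X i k * X' i k) := by
    simp only [Finset.sum_mul_sum]
    simp only [Finset.mul_sum, ← Finset.sum_add_distrib, ← Finset.sum_sub_distrib]
    refine Finset.sum_congr rfl fun k _ => Finset.sum_congr rfl fun l _ => ?_
    ring
  simp_rw [e, mul_pow, ← Finset.mul_sum]
  rw [key, one_div, inv_pow, inv_mul_eq_div]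
  gcongr
  nlinarith [mul_self_nonneg (∑ k, X i k * X' i k)]

theorem measurable_colBlock_add {d : ℕ} (c : ℕ) (C : Matrix (Fin d) (Fin d) ℝ) :
    Measurable fun (N : Matrix (Fin d) (Fin d) ℝ) (k : Fin (d / c)) => colBlock c (N + C) k := by
  refine measurable_pi_iff.2 fun k => measurable_pi_iff.2 fun i => measurable_pi_iff.2 fun j => ?_
  exact (measurable_entry i (blockIndex k j)).add_const (C i (blockIndex k j))

theorem noiseLevel_pos {ε δ : ℝ} {d n : ℕ} (hε : 0 < ε) (hn : 1 ≤ n) : 0 < noiseLevel ε δ d n := by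
  unfold noiseLevel
  have : (0 : ℝ) < n := by exact_mod_cast hn
  positivity

/-- Allowing any `σ` above the calibrated level covers both the calibrated noise and fixed noise
with a large batch. -/
theorem isDifferentiallyPrivate_of_noiseLevel_le {d n : ℕ} (c : ℕ) {ε δ σ : ℝ} (hn : 1 ≤ n)
    (hε : 0 < ε) (hδ : 0 < δ) (hd : δ * √(2 * Real.pi) ≤ (d : ℝ) ^ 2)
    (hσ : noiseLevel ε δ d n ≤ σ) :
    IsDifferentiallyPrivate (gaussianNoise d σ) (boundedDatasets d n) (streamUpdate c) ε δ := by
  intro X hX X' hX' ⟨i, hi⟩ S hS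
  have hσ0 : 0 < σ := (noiseLevel_pos hε hn).trans_le hσ
  have hn0 : (0 : ℝ) < n := by exact_mod_cast hn
  have hd1 : (1 : ℝ) ≤ d := by
    rcases Nat.eq_zero_or_pos d with rfl | h
    · have : 0 < δ * √(2 * Real.pi) := by positivity
      simp only [CharP.cast_eq_zero, ne_eq, OfNat.ofNat_ne_zero, not_false_eq_true, zero_pow] at hd
      linarith
    · exact_mod_cast h
  -- Post-processing: an event about the updates is pulled back to an event about the noise, so only
  -- the translation by `D` remains to be controlled.
  set T : Set (Matrix (Fin d) (Fin d) ℝ) := {N | (fun k => colBlock c (N + cov X') k) ∈ S}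
  have hT : MeasurableSet T := measurable_colBlock_add c (cov X') hS
  set D := cov X - cov X' with hD
  have e1 : {N | streamUpdate c X N ∈ S} = {N | N + D ∈ T} := by
    ext N
    have : streamUpdate c X N = fun k => colBlock c (N + D + cov X') k := by
      ext1 k
      rw [streamUpdate_eq, perturbedCov, hD]
      congr 1
      abel
    simp only [Set.mem_ofPred_eq, this, T]
  have e2 : {N | streamUpdate c X' N ∈ S} = T := by
    ext N
    have : streamUpdate c X' N = fun k => colBlock c (N + cov X') k := by
      ext1 k
      rw [streamUpdate_eq, perturbedCov, add_comm]
    simp only [Set.mem_ofPred_eq, this, T]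
  rw [e1, e2]
  set q := (d : ℝ) ^ 2 / (δ * √(2 * Real.pi)) with hq
  have hq1 : 1 ≤ q := (one_le_div (by positivity)).2 hd
  set t := √(2 * Real.log q) with ht
  have ht0 : 0 ≤ t := Real.sqrt_nonneg _
  have ht2 : t ^ 2 = 2 * Real.log q := Real.sq_sqrt (by linarith [Real.log_nonneg hq1])
  -- `1/s` bounds `‖D‖_F / σ`, the sensitivity in units of the noise.
  set s := σ * n / √2 with hs
  have hs_le : 2 * √2 * d * t / ε + 1 / √ε ≤ s := by
    have h2 : √2 * √2 = 2 := Real.mul_self_sqrt (by norm_num)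
    rw [hs, le_div_iff₀ (by positivity)]
    refine le_trans (le_of_eq ?_) (mul_le_mul_of_nonneg_right hσ hn0.le)
    simp only [noiseLevel, ← hq, ← ht]
    field_simp
    linear_combination (2 * (d : ℝ) * t * √ε) * h2
  have hs0 : 0 < s := by positivity
  have hsε : 1 / √ε ≤ s := le_trans (by linarith [show 0 ≤ 2 * √2 * d * t / ε by positivity]) hs_le
  have hεε : √ε * √ε = ε := Real.mul_self_sqrt hε.le
  have hsq : 0 < √ε := by positivity
  have h1s : 1 ≤ s * √ε := by rwa [div_le_iff₀ hsq] at hsε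
  have hεs : 1 ≤ ε * s ^ 2 := by
    calc (1 : ℝ) ≤ (s * √ε) ^ 2 := one_le_pow₀ h1s
      _ = ε * s ^ 2 := by rw [mul_pow, Real.sq_sqrt hε.le, mul_comm]
  -- This minimises the exponent `-λε + λ(λ+1)/(2s²)`, with minimum `-(λ/s)²/2`. The second summand
  -- of the noise level gives `ε s² ≥ 1`, hence the required `λ ≥ 1/2`.
  set lam := ε * s ^ 2 - 1 / 2 with hlam
  have hts : t * s ≤ lam := by
    have h1 : 2 * √2 * d * t * √ε + ε ≤ s * ε * √ε := by
      have := mul_le_mul_of_nonneg_right hs_le (by positivity : 0 ≤ ε * √ε)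
      have e : (2 * √2 * d * t / ε + 1 / √ε) * (ε * √ε) = 2 * √2 * d * t * √ε + ε := by
        field_simp
      linarith
    have h2 : t ≤ 2 * √2 * d * t := by
      have : (1 : ℝ) ≤ √2 := Real.one_le_sqrt.2 (by norm_num)
      have : 1 ≤ 2 * √2 * d := by nlinarith
      nlinarith
    -- Multiplied by `s`, this gives `ε s² ≥ t s + s √ε ≥ t s + 1`, more than enough for `t s ≤ λ`.
    have h3 : t + √ε ≤ s * ε := by
      have : t * √ε + √ε * √ε ≤ s * ε * √ε := by rw [hεε]; nlinarith
      exact le_of_mul_le_mul_right (by linarith) hsq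
    nlinarith
  refine gaussianNoise_add_mem_le hσ0 D hT (lam := lam) (by linarith) ?_
  have hDs : (∑ k, ∑ l, D k l ^ 2) / (2 * σ ^ 2) ≤ 1 / (2 * s ^ 2) := by
    calc (∑ k, ∑ l, D k l ^ 2) / (2 * σ ^ 2) ≤ 2 / (n : ℝ) ^ 2 / (2 * σ ^ 2) := by
          gcongr
          exact sum_sq_cov_sub_le hX hX' i hi
      _ = 1 / (2 * s ^ 2) := by
          rw [hs, div_pow, Real.sq_sqrt (by norm_num)]
          field_simp
  have hlam0 : 0 ≤ lam := by linarith
  have hexp : -(lam * ε) + lam * (lam + 1) * (∑ k, ∑ l, D k l ^ 2) / (2 * σ ^ 2) ≤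
      -Real.log q := by
    have h1 : lam * (lam + 1) * (∑ k, ∑ l, D k l ^ 2) / (2 * σ ^ 2) ≤
        lam * (lam + 1) * (1 / (2 * s ^ 2)) := by
      rw [mul_div_assoc]
      gcongr
    have h2 : -(lam * ε) + lam * (lam + 1) * (1 / (2 * s ^ 2)) = -((lam / s) ^ 2 / 2) := by
      have : ε = (lam + 1 / 2) / s ^ 2 := by rw [hlam]; field_simp; ring
      rw [this]
      field_simp
      ring
    have h3 : t ≤ lam / s := by rwa [le_div_iff₀ hs0]
    have h4 : t ^ 2 ≤ (lam / s) ^ 2 := by gcongr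
    linarith
  calc 1 / √(2 * Real.pi) *
        Real.exp (-(lam * ε) + lam * (lam + 1) * (∑ k, ∑ l, D k l ^ 2) / (2 * σ ^ 2))
      ≤ 1 / √(2 * Real.pi) * Real.exp (-Real.log q) := by gcongr
    _ = δ / (d : ℝ) ^ 2 := by
        rw [Real.exp_neg, Real.exp_log (by linarith), hq]
        field_simp
    _ ≤ δ := div_le_self hδ.le (one_le_pow₀ hd1)

theorem noiseLevel_le_of_minBatch_le {d n : ℕ} {ε δ ω₀ : ℝ} (hn : 1 ≤ n) (hω : 0 < ω₀)
    (h : minBatch ω₀ ε δ d ≤ n) : noiseLevel ε δ d n ≤ ω₀ := by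
  have hn0 : (0 : ℝ) < n := by exact_mod_cast hn
  have e : (d : ℝ) ^ 2 * δ⁻¹ * (2 * Real.pi) ^ (-(1 / 2) : ℝ) =
      (d : ℝ) ^ 2 / (δ * √(2 * Real.pi)) := by
    rw [Real.rpow_neg (by positivity), ← Real.sqrt_eq_rpow]
    ring
  rw [minBatch, e, inv_mul_le_iff₀ hω] at h
  refine le_of_mul_le_mul_right (le_trans (le_of_eq ?_) h) hn0
  rw [noiseLevel, add_mul, Real.sqrt_mul (by norm_num) ε⁻¹, Real.sqrt_inv]
  congr 1 <;> field_simp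

/-! ### Cones in the unit ball and a direction unlikely to be found -/

/-- The points of the unit ball making a small angle with the line through the unit vector `w`
occupy a small part of the ball. -/
theorem volume_cone_le {d : ℕ} (hd : 1 ≤ d) {τ : ℝ} (hτ0 : 0 ≤ τ) (hτ : τ < 1)
    {w : EuclideanSpace ℝ (Fin d)} (hw : ‖w‖ = 1) :
    volume {x : EuclideanSpace ℝ (Fin d) | ‖x‖ ≤ 1 ∧ τ * ‖x‖ ≤ |inner ℝ w x|} ≤
      ENNReal.ofReal (√2 * √(2 * (1 - τ ^ 2)) ^ (d - 1)) *
        volume (Metric.closedBall (0 : EuclideanSpace ℝ (Fin d)) 1) := by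
  have hτ2 : 0 < 1 - τ ^ 2 := by nlinarith
  set b := (√(2 * (1 - τ ^ 2)))⁻¹ with hb
  have hb0 : 0 < b := by positivity
  have hb2 : b ^ 2 = (2 * (1 - τ ^ 2))⁻¹ := by rw [hb, inv_pow, Real.sq_sqrt (by positivity)]
  set a := (√2)⁻¹ with ha
  have ha0 : 0 < a := by positivity
  have ha2 : a ^ 2 = 2⁻¹ := by rw [ha, inv_pow, Real.sq_sqrt (by positivity)]
  have hww : inner ℝ w w = (1 : ℝ) := by rw [real_inner_self_eq_norm_sq, hw, one_pow]
  -- `T` scales by `a` along `w` and by `b` on its orthogonal complement. On the cone each of the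
  -- two components of `T x` has squared norm at most `1/2`, so the cone lies in the preimage of the
  -- ball, whose volume is governed by `det T = b^(d-1) a`.
  set T : EuclideanSpace ℝ (Fin d) →ₗ[ℝ] EuclideanSpace ℝ (Fin d) :=
    b • LinearMap.transvection (innerₗ _ w) ((a / b - 1) • w) with hT
  have hTx : ∀ x, T x = b • (x + (inner ℝ w x * (a / b - 1)) • w) := by
    intro x
    simp [hT, LinearMap.transvection.apply, smul_smul]
  have hdet : LinearMap.det T = b ^ (d - 1) * a := by
    rw [hT, LinearMap.det_smul, LinearMap.transvection.det, finrank_euclideanSpace_fin]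
    obtain ⟨k, rfl⟩ : ∃ k, d = k + 1 := ⟨d - 1, by omega⟩
    simp only [map_smul, innerₗ_apply_apply, hww, smul_eq_mul, mul_one, Nat.add_sub_cancel]
    rw [pow_succ]
    field_simp
    ring
  have hdet0 : 0 < LinearMap.det T := by rw [hdet]; positivity
  have hnorm : ∀ x, ‖T x‖ ^ 2 = a ^ 2 * inner ℝ w x ^ 2 + b ^ 2 * (‖x‖ ^ 2 - inner ℝ w x ^ 2) := by
    intro x
    rw [hTx, norm_smul, mul_pow, norm_add_sq_real, inner_smul_right, norm_smul, hw,
      real_inner_comm, mul_one, Real.norm_eq_abs, Real.norm_eq_abs, sq_abs, sq_abs]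
    field_simp
    ring
  have hsub : {x : EuclideanSpace ℝ (Fin d) | ‖x‖ ≤ 1 ∧ τ * ‖x‖ ≤ |inner ℝ w x|} ⊆
      T ⁻¹' Metric.closedBall 0 1 := by
    rintro x ⟨hx1, hx2⟩
    rw [Set.mem_preimage, mem_closedBall_zero_iff]
    refine (sq_le_one_iff₀ (norm_nonneg _)).1 ?_
    rw [hnorm, ha2, hb2]
    have h1 : τ ^ 2 * ‖x‖ ^ 2 ≤ inner ℝ w x ^ 2 := by
      rw [← mul_pow, ← sq_abs (inner ℝ w x)]
      gcongr
    have h2 : ‖x‖ ^ 2 ≤ 1 := pow_le_one₀ (norm_nonneg _) hx1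
    have h3 : inner ℝ w x ^ 2 ≤ ‖x‖ ^ 2 := by
      rw [← sq_abs]
      have := abs_real_inner_le_norm w x
      rw [hw, one_mul] at this
      gcongr
    have h4 : (2 * (1 - τ ^ 2))⁻¹ * (‖x‖ ^ 2 - inner ℝ w x ^ 2) ≤ 2⁻¹ := by
      rw [inv_mul_le_iff₀ (by positivity)]
      nlinarith
    linarith
  calc _ ≤ volume (T ⁻¹' Metric.closedBall 0 1) := measure_mono hsub
    _ = ENNReal.ofReal |(LinearMap.det T)⁻¹| * volume (Metric.closedBall 0 1) :=
        Measure.addHaar_preimage_linearMap _ hdet0.ne' _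
    _ = _ := by
        rw [abs_of_pos (by positivity), hdet, mul_inv, ← inv_pow, hb, ha, inv_inv, inv_inv,
          mul_comm (√2)]

theorem norm_inner_toComplex_sq {d : ℕ} (v : EuclideanSpace ℝ (Fin d))
    (w : EuclideanSpace ℂ (Fin d)) :
    ‖inner ℂ (toComplex v) w‖ ^ 2 =
      inner ℝ (WithLp.toLp 2 fun i => (w i).re) v ^ 2 +
        inner ℝ (WithLp.toLp 2 fun i => (w i).im) v ^ 2 := by
  rw [← Complex.normSq_eq_norm_sq, Complex.normSq_apply]
  simp [toComplex, PiLp.inner_apply, pow_two, mul_comm]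

theorem norm_sq_eq_re_add_im {d : ℕ} (w : EuclideanSpace ℂ (Fin d)) :
    ‖w‖ ^ 2 = ‖(WithLp.toLp 2 fun i => (w i).re : EuclideanSpace ℝ (Fin d))‖ ^ 2 +
      ‖(WithLp.toLp 2 fun i => (w i).im : EuclideanSpace ℝ (Fin d))‖ ^ 2 := by
  rw [EuclideanSpace.norm_sq_eq, EuclideanSpace.real_norm_sq_eq, EuclideanSpace.real_norm_sq_eq,
    ← Finset.sum_add_distrib]
  refine Finset.sum_congr rfl fun i _ => ?_
  rw [← Complex.normSq_eq_norm_sq, Complex.normSq_apply]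
  simp [pow_two]

/-- A direction `p / ‖p‖` (or any direction if `p = 0`). -/
theorem exists_norm_eq_one_smul {d : ℕ} (hd : 1 ≤ d) (p : EuclideanSpace ℝ (Fin d)) :
    ∃ u : EuclideanSpace ℝ (Fin d), ‖u‖ = 1 ∧ p = ‖p‖ • u := by
  rcases eq_or_ne p 0 with rfl | hp
  · exact ⟨EuclideanSpace.single ⟨0, hd⟩ 1, by simp, by simp⟩
  · have := norm_ne_zero_iff.2 hp
    exact ⟨‖p‖⁻¹ • p, by rw [norm_smul, norm_inv, norm_norm, inv_mul_cancel₀ this],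
      by rw [smul_smul, mul_inv_cancel₀ this, one_smul]⟩

/-- The real and imaginary parts `p`, `q` of `w` satisfy `‖p‖² + ‖q‖² = 1`, so `|⟨x,w⟩|²` is a
weighted mean of the squared correlations of `x` with their directions. One of the two must exceed
the threshold, so two real cones cover the set. -/
theorem volume_complex_cone_le {d : ℕ} (hd : 1 ≤ d) {τ : ℝ} (hτ0 : 0 ≤ τ) (hτ : τ < 1)
    {w : EuclideanSpace ℂ (Fin d)} (hw : ‖w‖ = 1) :
    volume {x : EuclideanSpace ℝ (Fin d) | ‖x‖ ≤ 1 ∧ τ * ‖x‖ < ‖inner ℂ (toComplex x) w‖} ≤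
      ENNReal.ofReal (2 * √2 * √(2 * (1 - τ ^ 2)) ^ (d - 1)) *
        volume (Metric.closedBall (0 : EuclideanSpace ℝ (Fin d)) 1) := by
  set p : EuclideanSpace ℝ (Fin d) := WithLp.toLp 2 fun i => (w i).re with hp
  set q : EuclideanSpace ℝ (Fin d) := WithLp.toLp 2 fun i => (w i).im with hq
  obtain ⟨u, hu, hpu⟩ := exists_norm_eq_one_smul hd p
  obtain ⟨v, hv, hqv⟩ := exists_norm_eq_one_smul hd q
  have hsub : {x : EuclideanSpace ℝ (Fin d) | ‖x‖ ≤ 1 ∧ τ * ‖x‖ < ‖inner ℂ (toComplex x) w‖} ⊆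
      {x | ‖x‖ ≤ 1 ∧ τ * ‖x‖ ≤ |inner ℝ u x|} ∪ {x | ‖x‖ ≤ 1 ∧ τ * ‖x‖ ≤ |inner ℝ v x|} := by
    rintro x ⟨hx1, hx2⟩
    by_contra hcon
    simp only [Set.mem_union, Set.mem_ofPred_eq, not_or, not_and, not_le] at hcon
    have h1 := hcon.1 hx1
    have h2 := hcon.2 hx1
    have h3 := norm_inner_toComplex_sq x w
    have h4 := norm_sq_eq_re_add_im w
    rw [← hp, ← hq] at h3 h4
    rw [hw] at h4
    have e1 : inner ℝ p x ^ 2 = ‖p‖ ^ 2 * inner ℝ u x ^ 2 := by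
      conv_lhs => rw [hpu]
      rw [real_inner_smul_left, mul_pow]
    have e2 : inner ℝ q x ^ 2 = ‖q‖ ^ 2 * inner ℝ v x ^ 2 := by
      conv_lhs => rw [hqv]
      rw [real_inner_smul_left, mul_pow]
    have g1 : inner ℝ u x ^ 2 ≤ (τ * ‖x‖) ^ 2 := by
      rw [← sq_abs]; gcongr
    have g2 : inner ℝ v x ^ 2 ≤ (τ * ‖x‖) ^ 2 := by
      rw [← sq_abs]; gcongr
    have g3 : (τ * ‖x‖) ^ 2 < ‖inner ℂ (toComplex x) w‖ ^ 2 := by gcongr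
    nlinarith [mul_le_mul_of_nonneg_left g1 (sq_nonneg ‖p‖),
      mul_le_mul_of_nonneg_left g2 (sq_nonneg ‖q‖)]
  calc _ ≤ _ := measure_mono hsub
    _ ≤ _ := measure_union_le _ _
    _ ≤ _ := add_le_add (volume_cone_le hd hτ0 hτ hu) (volume_cone_le hd hτ0 hτ hv)
    _ = _ := by
        rw [← add_mul, ← ENNReal.ofReal_add (by positivity) (by positivity)]
        congr 2
        ring

theorem toComplex_smul {d : ℕ} (r : ℝ) (v : EuclideanSpace ℝ (Fin d)) :
    toComplex (r • v) = (r : ℂ) • toComplex v := by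
  ext i
  simp [toComplex]

theorem norm_inner_toComplex_smul {d : ℕ} (r : ℝ) (v : EuclideanSpace ℝ (Fin d))
    (w : EuclideanSpace ℂ (Fin d)) :
    ‖inner ℂ (toComplex (r • v)) w‖ = |r| * ‖inner ℂ (toComplex v) w‖ := by
  rw [toComplex_smul, inner_smul_left, norm_mul]
  simp

theorem norm_toComplex {d : ℕ} (v : EuclideanSpace ℝ (Fin d)) : ‖toComplex v‖ = ‖v‖ := by
  simp [EuclideanSpace.norm_eq, toComplex]

theorem continuous_toComplex {d : ℕ} : Continuous (toComplex (d := d)) := by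
  unfold toComplex
  fun_prop

/-- Some fixed direction is badly correlated with a random one. -/
theorem exists_norm_eq_one_measure_le {d : ℕ} (hd : 1 ≤ d) {τ : ℝ} (hτ0 : 0 ≤ τ) (hτ : τ < 1)
    {Ω : Type*} [MeasurableSpace Ω] (Q : Measure Ω) [IsProbabilityMeasure Q]
    {vhat : Ω → EuclideanSpace ℂ (Fin d)} (hv : Measurable vhat) (hv1 : ∀ A, ‖vhat A‖ = 1) :
    ∃ v : EuclideanSpace ℝ (Fin d), ‖v‖ = 1 ∧
      Q {A | τ < ‖inner ℂ (toComplex v) (vhat A)‖} ≤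
        ENNReal.ofReal (2 * √2 * √(2 * (1 - τ ^ 2)) ^ (d - 1)) := by
  have : Nonempty (Fin d) := ⟨⟨0, hd⟩⟩
  set B := Metric.closedBall (0 : EuclideanSpace ℝ (Fin d)) 1 with hB
  have hB0 : volume B ≠ 0 := (Metric.measure_closedBall_pos volume 0 one_pos).ne'
  have hBt : volume B ≠ ⊤ := measure_closedBall_lt_top.ne
  set μ := (volume : Measure (EuclideanSpace ℝ (Fin d))).restrict B with hμ
  have hμu : μ Set.univ = volume B := by rw [hμ, Measure.restrict_apply_univ]
  have : IsFiniteMeasure μ := ⟨by rw [hμu]; exact hBt.lt_top⟩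
  set E : Set (EuclideanSpace ℝ (Fin d) × Ω) :=
    {z | τ * ‖z.1‖ < ‖inner ℂ (toComplex z.1) (vhat z.2)‖} with hE
  have hEm : MeasurableSet E := by
    refine measurableSet_lt (by fun_prop) ?_
    exact ((continuous_toComplex.measurable.comp measurable_fst).inner
      (hv.comp measurable_snd)).norm
  set c := ENNReal.ofReal (2 * √2 * √(2 * (1 - τ ^ 2)) ^ (d - 1)) with hc
  -- Tonelli: for each fixed outcome `A`, the bad `x` form a complex cone around `vhat A`.
  have hint : ∫⁻ x, Q (Prod.mk x ⁻¹' E) ∂μ ≤ c * volume B := by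
    rw [← Measure.prod_apply hEm, Measure.prod_apply_symm hEm]
    calc ∫⁻ A, μ ((fun x => (x, A)) ⁻¹' E) ∂Q ≤ ∫⁻ _, c * volume B ∂Q := by
          refine lintegral_mono fun A => ?_
          refine le_trans (le_of_eq ?_) (volume_complex_cone_le hd hτ0 hτ (hv1 A))
          rw [hμ, Measure.restrict_apply (hEm.preimage measurable_prodMk_right)]
          congr 1
          ext x
          simp [hE, hB, and_comm]
      _ = c * volume B := by simp
  have hN : μ {0} = 0 := by
    rw [hμ]
    exact measure_mono_null (le_refl _) (by
      refine le_antisymm ((Measure.restrict_apply_le _ _).trans ?_) bot_le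
      simp)
  -- Some point does no worse than average. Excluding the null set `{0}` allows it to be normalised,
  -- and `E` is invariant under positive scaling of `x`.
  obtain ⟨x, hx0, hx⟩ := exists_notMem_null_le_laverage
    (μ := μ) (fun h => hB0 (by rw [← hμu, h]; rfl))
    (measurable_measure_prodMk_left (ν := Q) hEm).aemeasurable hN
  have hxn : 0 < ‖x‖ := norm_pos_iff.2 hx0
  refine ⟨‖x‖⁻¹ • x, by rw [norm_smul, norm_inv, norm_norm, inv_mul_cancel₀ hxn.ne'], ?_⟩
  have hxc : Q (Prod.mk x ⁻¹' E) ≤ c := by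
    refine hx.trans ?_
    rw [laverage_eq, hμu]
    exact ENNReal.div_le_of_le_mul hint
  refine le_trans (le_of_eq ?_) hxc
  congr 1
  ext A
  simp only [hE, Set.mem_ofPred_eq, Set.mem_preimage, norm_inner_toComplex_smul, abs_inv, abs_norm]
  rw [lt_inv_mul_iff₀ hxn, mul_comm]

/-! ### Relative entropy of a shift -/

theorem measurePreserving_entry {d : ℕ} (σ : ℝ) (i j : Fin d) :
    MeasurePreserving (fun N : Matrix (Fin d) (Fin d) ℝ => N i j) (gaussianNoise d σ)
      (gaussianReal 0 (σ ^ 2).toNNReal) :=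
  (measurePreserving_eval (fun _ : Fin d => gaussianReal 0 (σ ^ 2).toNNReal) j).comp
    (measurePreserving_eval (fun _ : Fin d => Measure.pi fun _ : Fin d =>
      gaussianReal 0 (σ ^ 2).toNNReal) i)

theorem integrable_entry {d : ℕ} (σ : ℝ) (i j : Fin d) :
    Integrable (fun N : Matrix (Fin d) (Fin d) ℝ => N i j) (gaussianNoise d σ) :=
  (measurePreserving_entry σ i j).integrable_comp_of_integrable
    ((memLp_id_gaussianReal 1).integrable le_rfl)

theorem integral_entry {d : ℕ} (σ : ℝ) (i j : Fin d) :
    ∫ N : Matrix (Fin d) (Fin d) ℝ, N i j ∂gaussianNoise d σ = 0 := by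
  have h := measurePreserving_entry (d := d) σ i j
  have h1 := integral_map (μ := gaussianNoise d σ) h.measurable.aemeasurable
    (f := fun x : ℝ => x) aestronglyMeasurable_id
  rw [h.map_eq, integral_id_gaussianReal] at h1
  exact h1.symm

theorem logRatio_add {d : ℕ} (σ : ℝ) (D N : Matrix (Fin d) (Fin d) ℝ) :
    logRatio σ D (N + D) =
      ∑ i, ∑ j, D i j / σ ^ 2 * N i j + (∑ i, ∑ j, D i j ^ 2) / (2 * σ ^ 2) := by
  simp only [logRatio, Finset.sum_div, ← Finset.sum_add_distrib]
  refine Finset.sum_congr rfl fun i _ => Finset.sum_congr rfl fun j _ => ?_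
  rw [Matrix.add_apply]
  ring

theorem integrable_logRatio_add {d : ℕ} (σ : ℝ) (D : Matrix (Fin d) (Fin d) ℝ) :
    Integrable (fun N => logRatio σ D (N + D)) (gaussianNoise d σ) := by
  simp only [logRatio_add]
  exact (integrable_finsetSum _ fun i _ => integrable_finsetSum _ fun j _ =>
    (integrable_entry σ i j).const_mul _).add (integrable_const _)

/-- The relative entropy of the shifted noise with respect to the unshifted one. -/
theorem integral_logRatio_add {d : ℕ} (σ : ℝ) (D : Matrix (Fin d) (Fin d) ℝ) :
    ∫ N, logRatio σ D (N + D) ∂gaussianNoise d σ = (∑ i, ∑ j, D i j ^ 2) / (2 * σ ^ 2) := by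
  have h : ∀ i, Integrable (fun N : Matrix (Fin d) (Fin d) ℝ => ∑ j, D i j / σ ^ 2 * N i j)
    (gaussianNoise d σ) := fun i => integrable_finsetSum _ fun j _ =>
      (integrable_entry σ i j).const_mul _
  simp only [logRatio_add]
  rw [integral_add (integrable_finsetSum _ fun i _ => h i) (integrable_const _),
    integral_finsetSum _ fun i _ => h i]
  simp_rw [integral_finsetSum _ fun j _ => (integrable_entry σ _ j).const_mul _,
    integral_const_mul, integral_entry]
  simp

/-- An event that is improbable for the noise alone cannot be very probable after a small shift. -/
theorem mul_measureReal_add_mem_le {d : ℕ} {σ : ℝ} (hσ : 0 < σ) (D : Matrix (Fin d) (Fin d) ℝ)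
    {G : Set (Matrix (Fin d) (Fin d) ℝ)} (hG : MeasurableSet G) {lam : ℝ}
    (h : gaussianNoise d σ G ≤ ENNReal.ofReal (Real.exp (-lam))) :
    lam * (gaussianNoise d σ).real {N | N + D ∈ G} ≤
      (∑ i, ∑ j, D i j ^ 2) / (2 * σ ^ 2) + Real.log 2 := by
  set Q := gaussianNoise d σ with hQ
  have hGD : MeasurableSet {N | N + D ∈ G} := measurable_add_matrix D hG
  set g : Matrix (Fin d) (Fin d) ℝ → ℝ := G.indicator fun _ => lam with hg
  have hgm : Measurable g := measurable_const.indicator hG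
  -- Donsker–Varadhan with test function `λ 1_G`: under the shifted law the factor `e^(-L)` undoes
  -- the change of measure, so `f` has mean `∫ e^g dQ ≤ 1 + e^λ Q(G) ≤ 2`.
  set f : Matrix (Fin d) (Fin d) ℝ → ℝ := fun N => Real.exp (g N - logRatio σ D N) with hf
  have hfm : Measurable f := (hgm.sub (measurable_logRatio σ D)).exp
  have hfD : Measurable fun N => f (N + D) := hfm.comp (measurable_add_matrix D)
  have hle : ∫⁻ N, ENNReal.ofReal (f (N + D)) ∂Q ≤ 2 := by
    rw [hQ, lintegral_gaussianNoise_add hσ D hfm.ennreal_ofReal]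
    calc _ ≤ ∫⁻ N, (1 + G.indicator (fun _ => ENNReal.ofReal (Real.exp lam)) N) ∂Q := by
          refine lintegral_mono fun N => ?_
          rw [← ENNReal.ofReal_mul (Real.exp_nonneg _), hf, ← Real.exp_add,
            add_sub_cancel, hg]
          by_cases hN : N ∈ G <;> simp [hN]
      _ = 1 + ENNReal.ofReal (Real.exp lam) * Q G := by
          rw [lintegral_add_left measurable_const, lintegral_indicator_const hG]
          simp
      _ ≤ 1 + ENNReal.ofReal (Real.exp lam) * ENNReal.ofReal (Real.exp (-lam)) := by gcongr
      _ = 2 := by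
          rw [← ENNReal.ofReal_mul (Real.exp_nonneg _), ← Real.exp_add, add_neg_cancel,
            Real.exp_zero, ENNReal.ofReal_one, one_add_one_eq_two]
  have hint : Integrable (fun N => f (N + D)) Q := by
    refine ⟨hfD.aestronglyMeasurable, ?_⟩
    rw [hasFiniteIntegral_iff_ofReal (ae_of_all _ fun N => Real.exp_nonneg _)]
    exact hle.trans_lt (by simp)
  have hint2 : ∫ N, f (N + D) ∂Q ≤ 2 := by
    rw [integral_eq_lintegral_of_nonneg_ae (ae_of_all _ fun N => Real.exp_nonneg _)
      hfD.aestronglyMeasurable]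
    exact ENNReal.toReal_le_of_le_ofReal (by norm_num) (by simpa using hle)
  have hgint : Integrable (fun N => g (N + D)) Q :=
    (integrable_const lam).indicator (μ := Q) hGD
  have hL := integrable_logRatio_add σ D
  have hgi : ∫ N, g (N + D) ∂Q = lam * Q.real {N | N + D ∈ G} := by
    calc ∫ N, g (N + D) ∂Q = ∫ N, {N | N + D ∈ G}.indicator (fun _ => lam) N ∂Q := rfl
      _ = _ := by rw [integral_indicator_const _ hGD, smul_eq_mul, mul_comm]
  have hmono : ∫ N, (g (N + D) - logRatio σ D (N + D) + (1 - Real.log 2)) ∂Q ≤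
      ∫ N, f (N + D) / 2 ∂Q := by
    refine integral_mono ((hgint.sub hL).add (integrable_const _)) (hint.div_const 2) fun N => ?_
    -- Jensen through the tangent line of `exp`, placed at `log 2` to match the bound `2` on the
    -- mean.
    have h1 := Real.add_one_le_exp (g (N + D) - logRatio σ D (N + D) - Real.log 2)
    rw [Real.exp_sub, Real.exp_log two_pos] at h1
    simp only [hf]
    linarith
  rw [integral_add (f := fun N => g (N + D) - logRatio σ D (N + D)) (hgint.sub hL)
    (integrable_const _), integral_sub hgint hL, hgi, integral_logRatio_add, integral_div] at hmono
  simp only [integral_const, probReal_univ, smul_eq_mul, one_mul] at hmono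
  linarith

/-! ### Expected correlation and distance of a random unit vector -/

theorem norm_inner_le_one {d : ℕ} {u w : EuclideanSpace ℂ (Fin d)} (hu : ‖u‖ = 1) (hw : ‖w‖ = 1) :
    ‖inner ℂ u w‖ ≤ 1 := by
  simpa [hu, hw] using norm_inner_le_norm (𝕜 := ℂ) u w

theorem sqrt_le_norm_sub {d : ℕ} {u w : EuclideanSpace ℂ (Fin d)} (hu : ‖u‖ = 1) (hw : ‖w‖ = 1) :
    √(2 * (1 - ‖inner ℂ u w‖)) ≤ ‖u - w‖ := by
  refine Real.sqrt_le_iff.2 ⟨norm_nonneg _, ?_⟩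
  have h1 : RCLike.re (inner ℂ u w) ≤ ‖inner ℂ u w‖ := RCLike.re_le_norm _
  rw [norm_sub_sq (𝕜 := ℂ), hu, hw]
  linarith

section RandomDirection

variable {d : ℕ} {Ω : Type*} [MeasurableSpace Ω] {Q : Measure Ω} [IsProbabilityMeasure Q]
  {u : EuclideanSpace ℂ (Fin d)} {w : Ω → EuclideanSpace ℂ (Fin d)} {τ p : ℝ}

theorem measurable_norm_inner (hw : Measurable w) : Measurable fun N => ‖inner ℂ u (w N)‖ :=
  (measurable_const.inner hw).norm

theorem integral_norm_inner_le_one (hu : ‖u‖ = 1) (hw1 : ∀ N, ‖w N‖ = 1) :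
    ∫ N, ‖inner ℂ u (w N)‖ ∂Q ≤ 1 := by
  have := norm_integral_le_of_norm_le_const (μ := Q) (f := fun N => ‖inner ℂ u (w N)‖) (C := 1)
    (ae_of_all _ fun N => by rw [norm_norm]; exact norm_inner_le_one hu (hw1 N))
  simp only [probReal_univ, mul_one] at this
  exact (le_abs_self _).trans this

theorem integral_norm_inner_le (hu : ‖u‖ = 1) (hw : Measurable w) (hw1 : ∀ N, ‖w N‖ = 1)
    (hτ : τ ≤ 1) (hp : Q.real {N | τ < ‖inner ℂ u (w N)‖} ≤ p) :
    ∫ N, ‖inner ℂ u (w N)‖ ∂Q ≤ τ + (1 - τ) * p := by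
  have hm := measurable_norm_inner (u := u) hw
  set G := {N | τ < ‖inner ℂ u (w N)‖} with hG
  have hGm : MeasurableSet G := measurableSet_lt measurable_const hm
  have hind : Integrable (G.indicator fun _ => 1 - τ) Q := (integrable_const _).indicator hGm
  calc ∫ N, ‖inner ℂ u (w N)‖ ∂Q ≤ ∫ N, (τ + G.indicator (fun _ => 1 - τ) N) ∂Q := by
        refine integral_mono (Integrable.of_bound hm.aestronglyMeasurable 1
          (ae_of_all _ fun N => ?_)) ((integrable_const _).add hind) fun N => ?_
        · rw [norm_norm]
          exact norm_inner_le_one hu (hw1 N)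
        · by_cases hN : N ∈ G
          · simpa [hN] using norm_inner_le_one hu (hw1 N)
          · simpa [hN] using not_lt.1 hN
    _ = τ + (1 - τ) * Q.real G := by
        rw [integral_add (integrable_const _) hind, integral_indicator_const _ hGm]
        simp [mul_comm]
    _ ≤ τ + (1 - τ) * p := by
        have : 0 ≤ 1 - τ := by linarith
        gcongr

theorem le_integral_norm_sub (hu : ‖u‖ = 1) (hw : Measurable w) (hw1 : ∀ N, ‖w N‖ = 1)
    (hp : Q.real {N | τ < ‖inner ℂ u (w N)‖} ≤ p) :
    (1 - p) * √(2 * (1 - τ)) ≤ ∫ N, ‖u - w N‖ ∂Q := by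
  have hm := measurable_norm_inner (u := u) hw
  set G := {N | τ < ‖inner ℂ u (w N)‖} with hG
  have hGm : MeasurableSet G := measurableSet_lt measurable_const hm
  have hind : Integrable (G.indicator fun _ => √(2 * (1 - τ))) Q :=
    (integrable_const _).indicator hGm
  calc (1 - p) * √(2 * (1 - τ)) ≤ (1 - Q.real G) * √(2 * (1 - τ)) := by gcongr
    _ = ∫ N, (√(2 * (1 - τ)) - G.indicator (fun _ => √(2 * (1 - τ))) N) ∂Q := by
        rw [integral_sub (integrable_const _) hind, integral_indicator_const _ hGm]
        simp [sub_mul]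
    _ ≤ ∫ N, ‖u - w N‖ ∂Q := by
        refine integral_mono ((integrable_const _).sub hind) (Integrable.of_bound
          (measurable_const.sub hw).norm.aestronglyMeasurable 2 (ae_of_all _ fun N => ?_))
          fun N => ?_
        · rw [norm_norm]
          refine (norm_sub_le _ _).trans ?_
          rw [hu, hw1]
          norm_num
        · by_cases hN : N ∈ G
          · simp [hN]
          · have h1 : ‖inner ℂ u (w N)‖ ≤ τ := not_lt.1 hN
            simp only [hN, not_false_eq_true, Set.indicator_of_notMem, sub_zero]
            refine le_trans (Real.sqrt_le_sqrt ?_) (sqrt_le_norm_sub hu (hw1 N))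
            linarith

end RandomDirection

/-! ### Datasets with all points equal -/

theorem cov_const {d n : ℕ} (hn : 1 ≤ n) (v : EuclideanSpace ℝ (Fin d)) (i j : Fin d) :
    cov (fun _ : Fin n => v) i j = v i * v j := by
  have : (n : ℝ) ≠ 0 := by positivity
  simp [cov, dataMatrix, Matrix.mul_apply, this]

theorem sum_sq_cov_const {d n : ℕ} (hn : 1 ≤ n) {v : EuclideanSpace ℝ (Fin d)} (hv : ‖v‖ = 1) :
    ∑ i, ∑ j, cov (fun _ : Fin n => v) i j ^ 2 = 1 := by
  have h : ∑ i, v i ^ 2 = 1 := by rw [← EuclideanSpace.real_norm_sq_eq, hv, one_pow]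
  simp_rw [cov_const hn, mul_pow, ← Finset.mul_sum, h, mul_one]
  exact h

theorem toEuclideanLin_cov_const {d n : ℕ} (hn : 1 ≤ n) (v x : EuclideanSpace ℝ (Fin d)) :
    Matrix.toEuclideanLin (cov fun _ : Fin n => v) x = inner ℝ v x • v := by
  ext i
  simp only [Matrix.toLpLin_apply, Matrix.mulVec, dotProduct, cov_const hn, PiLp.smul_apply,
    smul_eq_mul, PiLp.inner_apply, RCLike.inner_apply, conj_trivial, Finset.sum_mul]
  exact Finset.sum_congr rfl fun j _ => by ring

/-- The top eigenvectors of the covariance matrix of a constant dataset. -/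
theorem IsTopEigenvector.eq_smul {d n : ℕ} (hn : 1 ≤ n) {v v₁ : EuclideanSpace ℝ (Fin d)}
    (hv : ‖v‖ = 1) (h : IsTopEigenvector (cov fun _ : Fin n => v) v₁) :
    ∃ r : ℝ, |r| = 1 ∧ v₁ = r • v := by
  obtain ⟨h1, l, hl, hmax⟩ := h
  have hvv : inner ℝ v v = (1 : ℝ) := by rw [real_inner_self_eq_norm_sq, hv, one_pow]
  -- `v` itself has eigenvalue `1`, so the top eigenvalue is nonzero and the eigenvector equation
  -- puts `v₁` on the line of `v`.
  have hl1 : 1 ≤ l := by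
    refine hmax 1 (Module.End.hasEigenvalue_of_hasEigenvector (x := v) ⟨?_, ?_⟩)
    · rw [Module.End.mem_eigenspace_iff, toEuclideanLin_cov_const hn, hvv]
    · rintro rfl
      simp at hv
  have he := hl.apply_eq_smul
  rw [toEuclideanLin_cov_const hn] at he
  have hnorm : |inner ℝ v v₁| = l := by
    have := congrArg norm he
    rwa [norm_smul, norm_smul, hv, h1, mul_one, mul_one, Real.norm_eq_abs, Real.norm_eq_abs,
      abs_of_pos (by linarith : 0 < l)] at this
  have hle : |inner ℝ v v₁| ≤ 1 := by simpa [hv, h1] using abs_real_inner_le_norm v v₁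
  have hl' : l = 1 := by linarith
  exact ⟨inner ℝ v v₁, by rw [hnorm, hl'], by rw [he, hl', one_smul]⟩

/-- A constant dataset whose top eigenvector is hard to recover from the perturbed covariance. -/
theorem exists_dataset_of_fanoFactor_nonneg {d n : ℕ} (hd : 2 ≤ d) (hn : 1 ≤ n) {σ φ : ℝ}
    (hσ : 0 < σ) (hφ0 : 0 ≤ φ) (hφ1 : φ < 1)
    (hlam : 0 < ((d : ℝ) - 1) * Real.log (1 / √(1 - φ ^ 2)) - Real.log 8)
    (hF : 0 ≤ fanoFactor d σ φ)
    {vhat : Matrix (Fin d) (Fin d) ℝ → EuclideanSpace ℂ (Fin d)} (hm : Measurable vhat)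
    (hunit : ∀ A, ‖vhat A‖ = 1) :
    ∃ X ∈ boundedDatasets d n, ∀ v₁ : EuclideanSpace ℝ (Fin d), IsTopEigenvector (cov X) v₁ →
      expectedCorrelation X σ v₁ vhat ≤ correlationBound d σ φ ∧
        distanceBound d σ φ ≤ expectedDistance X σ v₁ vhat := by
  set lam := ((d : ℝ) - 1) * Real.log (1 / √(1 - φ ^ 2)) - Real.log 8 with hlam_def
  -- With this threshold `2(1 - τ²) = 1 - φ ≤ 1 - φ²`, which turns the cone bound into `e^(-lam)`,
  -- and `1 - τ ≥ (1 - φ)/4` since `1 + τ ≤ 2`.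
  set τ := √((1 + φ) / 2) with hτ
  have hτ2 : τ ^ 2 = (1 + φ) / 2 := Real.sq_sqrt (by linarith)
  have hτ0 : 0 ≤ τ := Real.sqrt_nonneg _
  have hτ1 : τ < 1 := by nlinarith
  obtain ⟨v, hv, hQ⟩ := exists_norm_eq_one_measure_le (by omega : 1 ≤ d) hτ0 hτ1
    (gaussianNoise d σ) hm hunit
  have hφ2 : 0 < 1 - φ ^ 2 := by nlinarith
  have hQ' : gaussianNoise d σ {A | τ < ‖inner ℂ (toComplex v) (vhat A)‖} ≤
      ENNReal.ofReal (Real.exp (-lam)) := by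
    refine hQ.trans (ENNReal.ofReal_le_ofReal ?_)
    have e : Real.exp (-lam) = 8 * √(1 - φ ^ 2) ^ (d - 1) := by
      have hd1 : ((d : ℝ) - 1) = ((d - 1 : ℕ) : ℝ) := by
        rw [Nat.cast_sub (by omega), Nat.cast_one]
      rw [hlam_def, hd1, neg_sub, Real.exp_sub, Real.exp_log (by norm_num), Real.exp_nat_mul,
        Real.exp_log (by positivity), one_div, inv_pow, div_inv_eq_mul]
    rw [e]
    have h2 : √2 ≤ 4 := Real.sqrt_le_iff.2 (by norm_num)
    have h3 : √(2 * (1 - τ ^ 2)) ≤ √(1 - φ ^ 2) := Real.sqrt_le_sqrt (by rw [hτ2]; nlinarith)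
    gcongr
    linarith
  -- `v` was chosen from the rule and the noise law alone, before any data; the covariance `v vᵀ`
  -- has Frobenius norm `1`.
  set X : Dataset d n := fun _ => v with hX
  have hmG : MeasurableSet {A | τ < ‖inner ℂ (toComplex v) (vhat A)‖} :=
    measurableSet_lt measurable_const (measurable_norm_inner hm)
  have hP := mul_measureReal_add_mem_le hσ (cov X) hmG hQ'
  rw [sum_sq_cov_const hn hv] at hP
  have hw : Measurable fun N => vhat (perturbedCov X N) := by
    have e : perturbedCov X = fun N => N + cov X := funext fun N => add_comm _ _
    exact hm.comp (e ▸ measurable_add_matrix (cov X))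
  refine ⟨X, fun _ => hv.le, fun v₁ hv₁ => ?_⟩
  obtain ⟨r, hr, rfl⟩ := hv₁.eq_smul hn hv
  have hu : ‖toComplex (r • v)‖ = 1 := by
    rw [norm_toComplex, norm_smul, hv, Real.norm_eq_abs, hr, mul_one]
  have hp : (gaussianNoise d σ).real
      {N | τ < ‖inner ℂ (toComplex (r • v)) (vhat (perturbedCov X N))‖} ≤
      1 - fanoFactor d σ φ := by
    have e : {N | τ < ‖inner ℂ (toComplex (r • v)) (vhat (perturbedCov X N))‖} =
        {N | N + cov X ∈ {A | τ < ‖inner ℂ (toComplex v) (vhat A)‖}} := by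
      ext N
      simp only [Set.mem_ofPred_eq, norm_inner_toComplex_smul, hr, one_mul, perturbedCov,
        add_comm (cov X)]
    rw [e, fanoFactor, sub_sub_cancel, le_div_iff₀ hlam, mul_comm]
    refine hP.trans ?_
    have : 1 / (2 * σ ^ 2) ≤ 1 / σ ^ 2 :=
      one_div_le_one_div_of_le (by positivity) (by nlinarith [sq_nonneg σ])
    linarith
  have hF1 : fanoFactor d σ φ ≤ 1 := by
    rw [fanoFactor]
    have : 0 ≤ (1 / σ ^ 2 + Real.log 2) / lam := by
      have := Real.log_nonneg one_le_two
      positivity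
    linarith
  have hτφ : (1 - φ) / 4 ≤ 1 - τ := by nlinarith [sq_nonneg (1 - τ)]
  constructor
  · refine (integral_norm_inner_le hu hw (fun _ => hunit _) hτ1.le hp).trans ?_
    rw [correlationBound]
    nlinarith [mul_le_mul_of_nonneg_right hτφ hF, mul_nonneg (by linarith : 0 ≤ (1 - φ) / 4)
      (mul_nonneg hF (by linarith : 0 ≤ 1 - fanoFactor d σ φ))]
  · refine le_trans ?_ (le_integral_norm_sub hu hw (fun _ => hunit _) hp)
    rw [distanceBound, sub_sub_cancel, mul_comm]
    gcongr
    refine (div_le_iff₀ two_pos).2 ?_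
    have : (2 : ℝ) = √4 := by
      rw [show (4 : ℝ) = 2 ^ 2 by norm_num, Real.sqrt_sq two_pos.le]
    conv_rhs => rw [this]
    rw [← Real.sqrt_mul (by nlinarith), ← this]
    exact Real.sqrt_le_sqrt (by linarith)

/-! ### Optimising over `φ` -/

theorem log_one_div_sqrt {φ : ℝ} (hφ0 : 0 ≤ φ) (hφ1 : φ < 1) :
    Real.log (1 / √(1 - φ ^ 2)) = -(Real.log (1 - φ ^ 2) / 2) := by
  rw [one_div, Real.log_inv, Real.log_sqrt (by nlinarith)]

theorem zero_lt_of_mem_phiRange {d : ℕ} (hd : 2 ≤ d) {σ φ : ℝ} (hφ : φ ∈ phiRange d σ) :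
    0 < φ := by
  have : 0 < 1 / √(2 * Real.pi * d) := by
    have : (0 : ℝ) < d := by positivity
    positivity
  exact this.trans_le ((le_max_left _ _).trans hφ.1)

/-- The denominator of `fanoFactor` on the range of `φ`. -/
theorem le_of_mem_phiRange {d : ℕ} (hd : 2 ≤ d) {σ φ : ℝ} (hφ : φ ∈ phiRange d σ) :
    1 / σ ^ 2 + Real.log 2 ≤ ((d : ℝ) - 1) * Real.log (1 / √(1 - φ ^ 2)) - Real.log 8 := by
  have hφ0 := zero_lt_of_mem_phiRange hd hφ
  have hφ1 : φ < 1 := hφ.2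
  have hd1 : (0 : ℝ) < (d : ℝ) - 1 := by
    have : (2 : ℝ) ≤ d := by exact_mod_cast hd
    linarith
  -- Only the third lower endpoint is needed: it gives `1/σ² + (log 256)/2 - log 8`, and `4 log 2 -
  -- 3 log 2 = log 2`.
  have h1 := ((le_max_right _ _).trans (le_max_right _ _)).trans hφ.1
  have hφ2 : 0 < 1 - φ ^ 2 := by nlinarith
  rw [Real.sqrt_le_left hφ0.le] at h1
  have h2 : Real.log (1 - φ ^ 2) ≤ -((2 / σ ^ 2 + Real.log 256) / (d - 1)) :=
    (Real.log_le_iff_le_exp hφ2).2 (by linarith)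
  rw [log_one_div_sqrt hφ0.le hφ1]
  have e : (2 / σ ^ 2 + Real.log 256) = ((d : ℝ) - 1) * ((2 / σ ^ 2 + Real.log 256) / (d - 1)) := by
    field_simp
  have h3 := mul_le_mul_of_nonneg_left h2 hd1.le
  rw [mul_neg, ← e] at h3
  have e8 : Real.log 8 = 3 * Real.log 2 := by
    rw [show (8 : ℝ) = 2 ^ 3 by norm_num, Real.log_pow]; norm_num
  have e256 : Real.log 256 = 8 * Real.log 2 := by
    rw [show (256 : ℝ) = 2 ^ 8 by norm_num, Real.log_pow]; norm_num
  have e1 : 2 / σ ^ 2 = 2 * (1 / σ ^ 2) := by ring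
  rw [e8]
  rw [e256, e1] at h3
  linarith

theorem one_div_sq_add_log_two_pos (σ : ℝ) : 0 < 1 / σ ^ 2 + Real.log 2 := by
  have := Real.log_pos one_lt_two
  positivity

theorem fanoFactor_mem_Icc {d : ℕ} (hd : 2 ≤ d) {σ φ : ℝ} (hφ : φ ∈ phiRange d σ) :
    fanoFactor d σ φ ∈ Set.Icc 0 1 := by
  have h1 := le_of_mem_phiRange hd hφ
  have h0 := one_div_sq_add_log_two_pos σ
  have hpos := h0.trans_le h1
  rw [fanoFactor]
  exact ⟨sub_nonneg.2 ((div_le_one hpos).2 h1), sub_le_self _ (by positivity)⟩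

theorem continuousOn_fanoFactor {d : ℕ} (hd : 2 ≤ d) (σ : ℝ) :
    ContinuousOn (fanoFactor d σ) (phiRange d σ) := by
  have hs : ∀ φ ∈ phiRange d σ, √(1 - φ ^ 2) ≠ 0 := fun φ hφ => by
    have h0 := zero_lt_of_mem_phiRange hd hφ
    have h1 : φ < 1 := hφ.2
    exact (Real.sqrt_pos.2 (by nlinarith)).ne'
  unfold fanoFactor
  refine continuousOn_const.sub (continuousOn_const.div ?_ fun φ hφ =>
    ((one_div_sq_add_log_two_pos σ).trans_le (le_of_mem_phiRange hd hφ)).ne')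
  refine (continuousOn_const.mul (ContinuousOn.log ?_ fun φ hφ =>
    one_div_ne_zero (hs φ hφ))).sub continuousOn_const
  exact continuousOn_const.div (by fun_prop) hs

theorem phiRange_left_lt_one {d : ℕ} (hd : 2 ≤ d) (σ : ℝ) :
    max (1 / √(2 * Real.pi * d))
      (max (√(1 - Real.exp (-(2 * Real.log (8 * d) / (d - 1)))))
        (√(1 - Real.exp (-((2 / σ ^ 2 + Real.log 256) / (d - 1)))))) < 1 := by
  have hs : ∀ x, √(1 - Real.exp x) < 1 := fun x => by
    rw [Real.sqrt_lt' one_pos]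
    linarith [Real.exp_pos x]
  have hd2 : (2 : ℝ) ≤ d := by exact_mod_cast hd
  refine max_lt ?_ (max_lt (hs _) (hs _))
  rw [div_lt_one (by positivity), Real.lt_sqrt one_pos.le]
  nlinarith [Real.pi_gt_three]

theorem exists_fanoFactor_pos {d : ℕ} (hd : 2 ≤ d) (σ : ℝ) :
    ∃ φ ∈ phiRange d σ, 0 < fanoFactor d σ φ := by
  obtain ⟨p, hp0, hp1⟩ := exists_between (phiRange_left_lt_one hd σ)
  have hmem0 := Set.left_mem_Ico.2 (phiRange_left_lt_one hd σ)
  have hmem : p ∈ phiRange d σ := ⟨hp0.le, hp1⟩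
  have h0 := le_of_mem_phiRange hd hmem0
  have hpos := zero_lt_of_mem_phiRange hd hmem0
  have hd1 : (0 : ℝ) < (d : ℝ) - 1 := by
    have : (2 : ℝ) ≤ d := by exact_mod_cast hd
    linarith
  refine ⟨p, hmem, ?_⟩
  have hlt : 1 / σ ^ 2 + Real.log 2 < ((d : ℝ) - 1) * Real.log (1 / √(1 - p ^ 2)) - Real.log 8 := by
    refine h0.trans_lt (sub_lt_sub_right (mul_lt_mul_of_pos_left ?_ hd1) _)
    rw [log_one_div_sqrt hpos.le hmem0.2, log_one_div_sqrt (hpos.trans hp0).le hp1]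
    have : Real.log (1 - p ^ 2) < Real.log (1 - (max (1 / √(2 * Real.pi * d))
      (max (√(1 - Real.exp (-(2 * Real.log (8 * d) / (d - 1)))))
        (√(1 - Real.exp (-((2 / σ ^ 2 + Real.log 256) / (d - 1))))))) ^ 2) := by
      refine Real.log_lt_log (by nlinarith) ?_
      have := pow_lt_pow_left₀ hp0 hpos.le two_ne_zero
      linarith
    linarith
  rw [fanoFactor, sub_pos, div_lt_one ((one_div_sq_add_log_two_pos σ).trans hlt)]
  exact hlt

/-- Both utility bounds are optimised by the `φ` maximising `(1 - φ) F(φ)²`. -/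
theorem exists_isMaxOn_phiRange {d : ℕ} (hd : 2 ≤ d) (σ : ℝ) :
    ∃ φ ∈ phiRange d σ, ∀ x ∈ phiRange d σ,
      (1 - x) * fanoFactor d σ x ^ 2 ≤ (1 - φ) * fanoFactor d σ φ ^ 2 := by
  obtain ⟨p, hp, hFp⟩ := exists_fanoFactor_pos hd σ
  have hp1 : p < 1 := hp.2
  have hFp1 := (fanoFactor_mem_Icc hd hp).2
  set g := (1 - p) * fanoFactor d σ p ^ 2 with hg
  have hg0 : 0 < g := mul_pos (by linarith) (by positivity)
  have hgp : g ≤ 1 - p := mul_le_of_le_one_right (by linarith) (pow_le_one₀ hFp.le hFp1)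
  -- The range is open at `1`, but the objective is at most `1 - x`, so beyond `1 - g` it is below
  -- its value `g` at `p`; compactness of `K` suffices.
  set K := Set.Icc (max (1 / √(2 * Real.pi * d))
      (max (√(1 - Real.exp (-(2 * Real.log (8 * d) / (d - 1)))))
        (√(1 - Real.exp (-((2 / σ ^ 2 + Real.log 256) / (d - 1))))))) (1 - g) with hK
  have hKsub : K ⊆ phiRange d σ := fun x hx => ⟨hx.1, by linarith [hx.2]⟩
  have hpK : p ∈ K := ⟨hp.1, by linarith⟩
  obtain ⟨φ, hφ, hmax⟩ := isCompact_Icc.exists_isMaxOn ⟨p, hpK⟩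
    (f := fun x => (1 - x) * fanoFactor d σ x ^ 2)
    ((continuousOn_const.sub continuousOn_id).mul
      (((continuousOn_fanoFactor hd σ).mono hKsub).pow 2))
  refine ⟨φ, hKsub hφ, fun x hx => ?_⟩
  rcases le_or_gt x (1 - g) with h | h
  · exact hmax ⟨hx.1, h⟩
  · have hF := fanoFactor_mem_Icc hd hx
    have hx1 : x < 1 := hx.2
    calc (1 - x) * fanoFactor d σ x ^ 2 ≤ 1 - x :=
          mul_le_of_le_one_right (by linarith) (pow_le_one₀ hF.1 hF.2)
      _ ≤ g := by linarith
      _ ≤ _ := hmax hpK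

/-- This exhibits the distance bound as an increasing function of the quantity that also governs the
correlation bound. -/
theorem distanceBound_eq_sqrt {d : ℕ} (hd : 2 ≤ d) {σ φ : ℝ} (hφ : φ ∈ phiRange d σ) :
    distanceBound d σ φ = √((1 - φ) * fanoFactor d σ φ ^ 2 / 2) := by
  have hF := fanoFactor_mem_Icc hd hφ
  have hφ1 : φ < 1 := hφ.2
  symm
  rw [distanceBound, Real.sqrt_eq_iff_mul_self_eq (by
    have : 0 ≤ 1 - φ := by linarith
    positivity) (mul_nonneg (by positivity) hF.1)]
  have := Real.mul_self_sqrt (by linarith : 0 ≤ 2 * (1 - φ))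
  linear_combination (-(fanoFactor d σ φ ^ 2) / 4) * this

/-! ### Sample complexity -/

/-- For this `φ` the logarithm in the denominator equals `10`. Hence the denominator `10(d-1) - log
8` is at least twice the numerator, which is at most `d + log 2`, for all `d ≥ 2`. -/
theorem sqrt_one_sub_exp_mem_phiRange {d : ℕ} (hd : 2 ≤ d) {σ : ℝ} (hσ : 1 / σ ^ 2 ≤ d) :
    √(1 - Real.exp (-20)) ∈ phiRange d σ ∧ 1 / 2 ≤ fanoFactor d σ (√(1 - Real.exp (-20))) := by
  have hd2 : (2 : ℝ) ≤ d := by exact_mod_cast hd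
  have hd1 : (0 : ℝ) < (d : ℝ) - 1 := by linarith
  have hlog2 := Real.log_two_lt_d9
  have hlogd := Real.log_le_sub_one_of_pos (by linarith : (0 : ℝ) < d)
  have e8 : Real.log 8 = 3 * Real.log 2 := by
    rw [show (8 : ℝ) = 2 ^ 3 by norm_num, Real.log_pow]; norm_num
  have e256 : Real.log 256 = 8 * Real.log 2 := by
    rw [show (256 : ℝ) = 2 ^ 8 by norm_num, Real.log_pow]; norm_num
  have hexp : Real.exp (-20) ≤ 1 / 2 := by
    rw [Real.exp_neg, one_div]
    exact inv_anti₀ two_pos (by linarith [Real.add_one_le_exp (20 : ℝ)])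
  have hsq : √(1 - Real.exp (-20)) ^ 2 = 1 - Real.exp (-20) := Real.sq_sqrt (by linarith)
  have hlt : √(1 - Real.exp (-20)) < 1 := by
    rw [Real.sqrt_lt' one_pos]
    linarith [Real.exp_pos (-20)]
  have hs : ∀ x : ℝ, x ≤ 20 → √(1 - Real.exp (-x)) ≤ √(1 - Real.exp (-20)) := fun x hx =>
    Real.sqrt_le_sqrt (sub_le_sub_left (Real.exp_le_exp.2 (by linarith)) _)
  refine ⟨⟨max_le ?_ (max_le (hs _ ?_) (hs _ ?_)), hlt⟩, ?_⟩
  · rw [one_div, ← Real.sqrt_inv]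
    refine Real.sqrt_le_sqrt (le_trans (inv_anti₀ two_pos ?_) (by linarith : (2 : ℝ)⁻¹ ≤ _))
    nlinarith [Real.pi_gt_three]
  · rw [div_le_iff₀ hd1, Real.log_mul (by norm_num) (by linarith), e8]
    linarith
  · rw [div_le_iff₀ hd1, e256, show 2 / σ ^ 2 = 2 * (1 / σ ^ 2) by ring]
    linarith
  · have hden : 0 < ((d : ℝ) - 1) * 10 - 3 * Real.log 2 := by linarith
    rw [fanoFactor, log_one_div_sqrt (Real.sqrt_nonneg _) hlt, hsq, sub_sub_cancel, Real.log_exp,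
      e8, show -(-20 / 2 : ℝ) = 10 by norm_num, le_sub_comm, div_le_iff₀ hden]
    linarith

/-- Noise of standard deviation below `1 / √d` requires many samples. -/
theorem le_of_noiseLevel_lt {d n : ℕ} {ε δ : ℝ} (hd : 2 ≤ d) (hn : 1 ≤ n) (hε : 0 < ε)
    (hδ : 0 < δ) (hδ1 : δ < 1) (h : noiseLevel ε δ d n < 1 / √d) :
    (d : ℝ) ^ (3 / 2 : ℝ) * √(Real.log (d / δ)) / ε ≤ n := by
  have hd2 : (2 : ℝ) ≤ d := by exact_mod_cast hd
  have hn0 : (0 : ℝ) < n := by exact_mod_cast hn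
  have hsd : 0 < √(d : ℝ) := by positivity
  -- After squaring inside the logarithm this says `2πδ ≤ d³`, which follows from `2π < 8 ≤ d³`.
  have hlog : √(Real.log (d / δ)) ≤
      √(2 * Real.log ((d : ℝ) ^ 2 / (δ * √(2 * Real.pi)))) := by
    refine Real.sqrt_le_sqrt ?_
    have e : 2 * Real.log ((d : ℝ) ^ 2 / (δ * √(2 * Real.pi))) =
        Real.log (((d : ℝ) ^ 2 / (δ * √(2 * Real.pi))) ^ 2) := by
      rw [Real.log_pow]; norm_num
    rw [e]
    refine Real.log_le_log (by positivity) ?_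
    rw [div_pow, mul_pow, Real.sq_sqrt (by positivity), div_le_div_iff₀ hδ (by positivity)]
    have h8 : (8 : ℝ) ≤ (d : ℝ) ^ 3 := by
      calc (8 : ℝ) = 2 ^ 3 := by norm_num
        _ ≤ _ := by gcongr
    have h7 : δ * (2 * Real.pi) ≤ (d : ℝ) ^ 3 := by nlinarith [Real.pi_lt_d2, Real.pi_pos]
    calc (d : ℝ) * (δ ^ 2 * (2 * Real.pi)) = (d * δ) * (δ * (2 * Real.pi)) := by ring
      _ ≤ (d * δ) * (d : ℝ) ^ 3 := by gcongr
      _ = _ := by ring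
  have hpow : (d : ℝ) ^ (3 / 2 : ℝ) = d * √d := by
    rw [show (3 / 2 : ℝ) = 1 + 1 / 2 by norm_num, Real.rpow_add (by linarith), Real.rpow_one,
      Real.sqrt_eq_rpow]
  have h1 : d / (ε * n) * √(Real.log (d / δ)) ≤ noiseLevel ε δ d n := by
    calc d / (ε * n) * √(Real.log (d / δ)) ≤ 4 * d / (ε * n) *
          √(2 * Real.log ((d : ℝ) ^ 2 / (δ * √(2 * Real.pi)))) := by
          gcongr
          linarith
      _ ≤ _ := le_add_of_nonneg_right (by positivity)
  have h2 := h1.trans h.le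
  rw [le_div_iff₀ hsd] at h2
  rw [hpow]
  calc (d : ℝ) * √d * √(Real.log (d / δ)) / ε =
        d / (ε * n) * √(Real.log (d / δ)) * √d * n := by field_simp
    _ ≤ 1 * n := by gcongr
    _ = n := one_mul _

end StreamingDP

theorem mainTheorem2 :
    -- parts 1 and 2: privacy of the sequence of all streaming updates
    (∀ (d n c : ℕ) (ε δ : ℝ), 1 ≤ n → 0 < ε → 0 < δ → δ < 1 →
      δ * √(2 * Real.pi) ≤ (d : ℝ) ^ 2 →
      StreamingDP.IsDifferentiallyPrivate
          (StreamingDP.gaussianNoise d (StreamingDP.noiseLevel ε δ d n))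
          (StreamingDP.boundedDatasets d n) (StreamingDP.streamUpdate c) ε δ ∧
      ∀ ω₀ : ℝ, 0 < ω₀ → StreamingDP.minBatch ω₀ ε δ d ≤ n →
        StreamingDP.IsDifferentiallyPrivate (StreamingDP.gaussianNoise d ω₀)
          (StreamingDP.boundedDatasets d n) (StreamingDP.streamUpdate c) ε δ) ∧
    -- part 3: utility bounds and sample complexity, with absolute constants `C₁`, `C₂`
    (∃ C₁ > (0 : ℝ), ∃ C₂ > (0 : ℝ), ∀ (d n : ℕ) (ε δ : ℝ),
      2 ≤ d → 1 ≤ n → 0 < ε → 0 < δ → δ < 1 →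
      ∀ vhat : Matrix (Fin d) (Fin d) ℝ → EuclideanSpace ℂ (Fin d),
        Measurable vhat → (∀ A, ‖vhat A‖ = 1) →
        ∃ a b : ℝ,
          IsLeast (StreamingDP.correlationBound d (StreamingDP.noiseLevel ε δ d n) ''
            StreamingDP.phiRange d (StreamingDP.noiseLevel ε δ d n)) a ∧
          IsGreatest (StreamingDP.distanceBound d (StreamingDP.noiseLevel ε δ d n) ''
            StreamingDP.phiRange d (StreamingDP.noiseLevel ε δ d n)) b ∧
          ∃ X ∈ StreamingDP.boundedDatasets d n,
            ∀ v₁ : EuclideanSpace ℝ (Fin d),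
              StreamingDP.IsTopEigenvector (StreamingDP.cov X) v₁ →
              StreamingDP.expectedCorrelation X (StreamingDP.noiseLevel ε δ d n) v₁ vhat ≤ a ∧
              b ≤ StreamingDP.expectedDistance X (StreamingDP.noiseLevel ε δ d n) v₁ vhat ∧
              C₁ * ((d : ℝ) ^ (3 / 2 : ℝ) * √(Real.log (d / δ)) / ε) *
                (1 - C₂ * (1 - StreamingDP.expectedCorrelation X
                  (StreamingDP.noiseLevel ε δ d n) v₁ vhat)) ≤ n) := by
  open StreamingDP in
  have hφs : 0 < 1 - √(1 - Real.exp (-20)) := by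
    rw [sub_pos, Real.sqrt_lt' one_pos]
    linarith [Real.exp_pos (-20)]
  refine ⟨fun d n c ε δ hn hε hδ _ hd => ⟨isDifferentiallyPrivate_of_noiseLevel_le c hn hε hδ hd
    le_rfl, fun ω₀ hω h => isDifferentiallyPrivate_of_noiseLevel_le c hn hε hδ hd
      (noiseLevel_le_of_minBatch_le hn hω h)⟩,
    1, one_pos, 16 / (1 - √(1 - Real.exp (-20))), by positivity, ?_⟩
  intro d n ε δ hd hn hε hδ hδ1 vhat hm hunit
  have hσ : 0 < noiseLevel ε δ d n := noiseLevel_pos hε hn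
  set σ := noiseLevel ε δ d n with hσ_def
  obtain ⟨φ, hφ, hmax⟩ := exists_isMaxOn_phiRange hd σ
  obtain ⟨X, hX, hXv⟩ := exists_dataset_of_fanoFactor_nonneg hd hn hσ
    (zero_lt_of_mem_phiRange hd hφ).le hφ.2
    ((one_div_sq_add_log_two_pos σ).trans_le (le_of_mem_phiRange hd hφ))
    (fanoFactor_mem_Icc hd hφ).1 hm hunit
  refine ⟨correlationBound d σ φ, distanceBound d σ φ, ⟨⟨φ, hφ, rfl⟩, ?_⟩, ⟨⟨φ, hφ, rfl⟩, ?_⟩,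
    X, hX, fun v₁ hv₁ => ⟨(hXv v₁ hv₁).1, (hXv v₁ hv₁).2, ?_⟩⟩
  · rintro _ ⟨x, hx, rfl⟩
    have := hmax x hx
    rw [correlationBound, correlationBound]
    linarith
  · rintro _ ⟨x, hx, rfl⟩
    have := hmax x hx
    rw [distanceBound_eq_sqrt hd hx, distanceBound_eq_sqrt hd hφ]
    gcongr
  have hcorr := (hXv v₁ hv₁).1
  have hd0 : (0 : ℝ) < d := by positivity
  have hK : 0 ≤ (d : ℝ) ^ (3 / 2 : ℝ) * √(Real.log (d / δ)) / ε := by positivity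
  rw [one_mul]
  -- For small noise the factor multiplying the bound is at most `1` and `n` is already large. For
  -- large noise, maximality of `φ` against `q` gives `1 - E|⟨v₁, v̂₁⟩| ≥ (1-q)/16`, which is why
  -- `C₂ = 16/(1-q)`.
  rcases lt_or_ge σ (1 / √d) with h | h
  · have hu : ‖toComplex v₁‖ = 1 := by rw [norm_toComplex, hv₁.1]
    have hle1 : expectedCorrelation X σ v₁ vhat ≤ 1 :=
      integral_norm_inner_le_one hu fun _ => hunit _
    refine le_trans (mul_le_of_le_one_right hK ?_) (le_of_noiseLevel_lt hd hn hε hδ hδ1 h)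
    exact sub_le_self _ (mul_nonneg (by positivity) (by linarith))
  · have h1 : 1 / σ ^ 2 ≤ d := by
      have h2 := pow_le_pow_left₀ (by positivity) h 2
      rw [div_pow, one_pow, Real.sq_sqrt hd0.le] at h2
      rw [one_div_le (by positivity) hd0]
      exact h2
    obtain ⟨hs, hF⟩ := sqrt_one_sub_exp_mem_phiRange hd h1
    have h3 := hmax _ hs
    set q := √(1 - Real.exp (-20))
    have h4 : (1 - q) / 4 ≤ (1 - q) * fanoFactor d σ q ^ 2 := by
      have : 1 / 4 ≤ fanoFactor d σ q ^ 2 := by nlinarith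
      rw [div_eq_mul_one_div]
      gcongr
    rw [correlationBound] at hcorr
    have h5 : (1 - q) / 16 ≤ 1 - expectedCorrelation X σ v₁ vhat := by linarith
    have h6 : 1 ≤ 16 / (1 - q) * (1 - expectedCorrelation X σ v₁ vhat) := by
      calc (1 : ℝ) = 16 / (1 - q) * ((1 - q) / 16) := by field_simp
        _ ≤ _ := by gcongr
    exact (mul_nonpos_of_nonneg_of_nonpos hK (by linarith)).trans (Nat.cast_nonneg n)
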